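/- Let $q$ be a power of an odd prime $p$, $\mathbb{A}=\mathbb{F}_q[T]$, $k=\mathbb{F}_q(T)$, and let $\Omega$ be the completion of an algebraic closure of $\mathbb{F}_q((1/T))$. Let $\bar\pi\in\Omega^*$ be a period of the Carlitz module, i.e. $e_C(x)=x\prod_{0\ne a\in\mathbb{A}}\bigl(1-\frac{x}{\bar\pi a}\bigr)$ satisfies $e_C(Tx)=Te_C(x)+e_C(x)^q$ for all $x\in\Omega$. Fix a $(q-1)$-st root $\sqrt[q-1]{-1}\in\Omega$ of $-1$, square roots in $\Omega$ of the elements of $\mathbb{A}$, and a generator $\gamma$ of $\mathbb{F}_q^*$. For $x\in k\setminus\mathbb{A}$ put $\sin[x]=\sqrt[q-1]{-1}\cdot e_C(\bar\pi\{x\}/\operatorname{sgn}\{x\})$, where $\{x\}$ is the part of the expansion of $x$ in $\mathbb{F}_q((1/T))$ in negative powers of $T$ and $\operatorname{sgn}$ is the leading coefficient; put $\sin[x]=1$ for $x\in\mathbb{A}$; and extend $\sin$ multiplicatively to the free abelian group on the symbols $[x]$, $x\in k/\mathbb{A}$. Let $M\in\mathbb{A}$ be monic, let $S_M$ be the set of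 monic prime factors of $M$, and let $P\neq Q$ be in $S_M$, of degrees $d_P$, $d_Q$. Put $$\mathbf{a}_{PQ}=\sum_{\substack{A\text{ monic}\\ \deg A<d_Q}}\ \sum_{\substack{B\text{ monic}\\ \deg B<d_P}}\ \sum_{s=1}^{q-2}s\left(\left[\frac{BQ+\gamma^{-s}A}{PQ}\right]-\left[\frac{AP+\gamma^{-s}B}{PQ}\right]\right),$$ and let $u=\sin\mathbf{a}_{PQ}$, $\sqrt{P}\sin\mathbf{a}_{PQ}$, $\sqrt{Q}\sin\mathbf{a}_{PQ}$ or $\sqrt{PQ}\sin\mathbf{a}_{PQ}$, according as $(d_P,d_Q)$ is (even, even), (even, odd), (odd, even) or (odd, odd). Let $K=k(e_C(\bar\pi/M))$ and $\widetilde K=K(\sqrt[q-1]{u})$, where $\sqrt[q-1]{u}$ is any $(q-1)$-st root of $u$ in $\Omega$. Let $G=\mathrm{Gal}(K/k)$ and $\widetilde G=\mathrm{Gal}(\widetilde K/k)$ be the groups of $k$-automorphisms, and let $\epsilon$ be a generator of $\mathrm{Gal}(\widetilde K/K)$. For a subgroup $H\le G$ let $\widetilde H\le\widetilde G$ be the subgroup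 of all liftings of elements of $H$, i.e. of all $\tau\in\widetilde G$ with $\tau|_K\in H$. Then there is an isomorphism $\varphi\colon G\to(\mathbb{A}/M\mathbb{A})^*$ such that $\sigma(e_C(\bar\pi/M))=e_C(a\bar\pi/M)$ whenever $\varphi(\sigma)=a\bmod M$, and the following hold. Let $\widetilde G^{(p)}$, $G^{(p)}$ be the $p$-Sylow subgroups of $\widetilde G$ and $G$. Then $\langle\epsilon\rangle$ is a normal subgroup of $\widetilde{G^{(p)}}$, $$\widetilde G^{(p)}\;\cong\;\widetilde{G^{(p)}}/\langle\epsilon\rangle\;\cong\;G^{(p)},$$ and $G^{(p)}$ is isomorphic to the $p$-Sylow subgroup of $(\mathbb{A}/M\mathbb{A})^*$. For every $L\in S_M$, with $L^r$ the exact power of $L$ in $M$, let $\sigma_L\in G$ be such that $\varphi(\sigma_L)$ is $1$ modulo $M/L^r$, has $(q^{\deg L}-1)$-st power $1$, and generates $(\mathbb{A}/L\mathbb{A})^*$ modulo $L$. Let $G'=\langle\sigma_L : L\in S_M\rangle$. Then $\widetilde G$ is the (internal) direct product $\widetilde G=\widetilde G^{(p)}\times\widetilde{G'}$. -/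

import Mathlib

open Polynomial

namespace QuasiCyclotomic

noncomputable section

section Completion

variable (F : Type*) [Field F]

open scoped Classical in
/-- `F((1/T))`, the completion of `k = F(T)` at the place `1/T`. -/
abbrev KInf : Type _ := RatFunc.CompletionAtInfty F

open scoped Classical in
instance : CompleteSpace (KInf F) := by
  let : UniformSpace (RatFunc F) := (RatFunc.inftyValued F).toUniformSpace
  exact inferInstanceAs (CompleteSpace (UniformSpace.Completion (RatFunc F)))

variable [Finite F]

open scoped NNReal in
theorem one_lt_card : (1 : ℝ≥0) < (Nat.card F : ℝ≥0) := by
  exact_mod_cast Finite.one_lt_card (α := F)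

open scoped Classical in
/-- The valuation of `F((1/T))` is made into an absolute value with `|T| = q`. -/
instance : Valuation.RankOne (Valued.v (R := KInf F) (Γ₀ := WithZero (Multiplicative ℤ))) where
  hom' := (WithZeroMulInt.toNNReal (one_lt_card F).ne_zero).comp
    MonoidWithZeroHom.ValueGroup₀.embedding
  strictMono' := (WithZeroMulInt.toNNReal_strictMono (one_lt_card F)).comp
    MonoidWithZeroHom.ValueGroup₀.embedding_strictMono
  exists_val_nontrivial := by
    let := RatFunc.inftyValued F
    refine ⟨((RatFunc.X : RatFunc F) : UniformSpace.Completion (RatFunc F)), ?_⟩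
    have h : Valued.v (R := UniformSpace.Completion (RatFunc F))
        ((RatFunc.X : RatFunc F) : UniformSpace.Completion (RatFunc F)) =
        (WithZero.exp 1 : WithZero (Multiplicative ℤ)) := by
      rw [Valued.valuedCompletion_apply]
      exact RatFunc.inftyValuation.X F
    change Valued.v (R := UniformSpace.Completion (RatFunc F)) _ ≠ 0 ∧
      Valued.v (R := UniformSpace.Completion (RatFunc F)) _ ≠ 1
    rw [h]
    exact ⟨WithZero.exp_ne_zero, by rw [← WithZero.exp_zero]; simp⟩

open scoped Classical in
instance : NontriviallyNormedField (KInf F) :=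
  Valued.toNontriviallyNormedField (KInf F) (WithZero (Multiplicative ℤ))

open scoped Classical in
instance : IsUltrametricDist (KInf F) :=
  inferInstanceAs (@IsUltrametricDist (KInf F)
    (Valued.toNormedField (KInf F) (WithZero (Multiplicative ℤ))).toDist)

/-- The algebraic closure of `F((1/T))`, with the unique extension of the absolute value. -/
abbrev KInfBar : Type _ := AlgebraicClosure (KInf F)

instance : NormedField (KInfBar F) := spectralNorm.normedField (KInf F) (KInfBar F)

/-- `Ω`, the completion of the algebraic closure of `F((1/T))`. -/
def Omega : Type _ := UniformSpace.Completion (KInfBar F)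

instance : NormedField (Omega F) := inferInstanceAs (NormedField (UniformSpace.Completion (KInfBar F)))

instance : CompleteSpace (Omega F) :=
  inferInstanceAs (CompleteSpace (UniformSpace.Completion (KInfBar F)))

/-- The canonical embedding of `KInfBar F` into its completion `Ω`. -/
def ofKInfBar : KInfBar F →+* Omega F := UniformSpace.Completion.coeRingHom

open scoped Classical in
/-- `Ω` as an extension of `k = F(T)`, through `k → F((1/T))`. -/
instance : Algebra (RatFunc F) (Omega F) :=
  ((ofKInfBar F).comp ((algebraMap (KInf F) (KInfBar F)).comp
    (algebraMap (RatFunc F) (KInf F)))).toAlgebra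

end Completion

section Carlitz

variable {F : Type*} [Field F] [Finite F]

/-- The inclusion of `𝔸 = F[T]` in `Ω`. -/
def polyMap : F[X] →+* Omega F :=
  (algebraMap (RatFunc F) (Omega F)).comp (algebraMap F[X] (RatFunc F))

/-- The exponential function `x ∏_{0 ≠ u ∈ π𝔸} (1 - x / u)` of the lattice `π𝔸` in `Ω`. -/
def latticeExp (π x : Omega F) : Omega F :=
  x * ∏' a : {a : F[X] // a ≠ 0}, (1 - x / (π * polyMap a.1))

/-- `π` is a period of the Carlitz module `C_T = T + τ`, `τ x = x ^ q`: the lattice `π𝔸` has rank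
one and its exponential function `e` satisfies `e (T x) = C_T (e x)`. -/
def IsCarlitzPeriod (π : Omega F) : Prop :=
  π ≠ 0 ∧ ∀ x : Omega F,
    latticeExp π (polyMap X * x) = polyMap X * latticeExp π x + latticeExp π x ^ Nat.card F

/-- The cyclotomic function field `K = k(e_C(π / M))` of conductor `M`. -/
def cyclotomicField (π : Omega F) (M : F[X]) : IntermediateField (RatFunc F) (Omega F) :=
  IntermediateField.adjoin (RatFunc F) {latticeExp π (π / polyMap M)}

end Carlitz

section Sine

variable {F : Type*} [Field F]

variable (F) in
/-- `𝔸 = F[T]` as a subgroup of `k = F(T)`. -/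
def polySubgroup : AddSubgroup (RatFunc F) :=
  (algebraMap F[X] (RatFunc F)).toAddMonoidHom.range

/-- The fractional part `{x}` of `x ∈ k`: the part of the expansion of `x` in `F((1/T))` in
negative powers of `T`. -/
def fracPart (x : RatFunc F) : RatFunc F :=
  algebraMap F[X] (RatFunc F) (x.num % x.denom) / algebraMap F[X] (RatFunc F) x.denom

theorem fracPart_eq_of_rel (x y : RatFunc F)
    (h : QuotientAddGroup.leftRel (polySubgroup F) x y) : fracPart x = fracPart y := by
  rw [QuotientAddGroup.leftRel_apply] at h
  obtain ⟨a, ha⟩ := h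
  have ha' : algebraMap F[X] (RatFunc F) a = -x + y := ha
  have hd : algebraMap F[X] (RatFunc F) x.denom ≠ 0 := by
    simpa using x.denom_ne_zero
  have hy : y = algebraMap F[X] (RatFunc F) (x.num + a * x.denom) /
      algebraMap F[X] (RatFunc F) x.denom := by
    rw [map_add, map_mul, add_div, mul_div_cancel_right₀ _ hd, RatFunc.num_div_denom, ha']
    ring
  have h1 := (RatFunc.num_mul_eq_mul_denom_iff x.denom_ne_zero).2 hy
  have hc : IsCoprime x.denom (x.num + a * x.denom) := by
    simpa [mul_comm] using (RatFunc.isCoprime_num_denom x).symm.add_mul_left_right a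
  have e : x.denom = y.denom := by
    refine eq_of_monic_of_associated x.monic_denom y.monic_denom
      (associated_of_dvd_dvd ?_ ?_)
    · exact hc.dvd_of_dvd_mul_left (h1 ▸ dvd_mul_left _ _)
    · exact (RatFunc.isCoprime_num_denom y).symm.dvd_of_dvd_mul_left (h1 ▸ dvd_mul_left _ _)
  rw [← e] at h1
  have h2 := mul_right_cancel₀ x.denom_ne_zero h1
  have h3 : a * x.denom % x.denom = 0 := EuclideanDomain.mod_eq_zero.2 (dvd_mul_left _ _)
  rw [fracPart, fracPart, h2, ← e, Polynomial.add_mod, h3, add_zero]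

/-- The fractional part of a class in `k / 𝔸`. -/
def fracRep : RatFunc F ⧸ polySubgroup F → RatFunc F :=
  Quotient.lift fracPart fracPart_eq_of_rel

/-- The sign, i.e. the leading coefficient of the expansion in `F((1/T))`, of `x ∈ k`. -/
def sgn (x : RatFunc F) : F := x.num.leadingCoeff / x.denom.leadingCoeff

variable [Finite F]

open scoped Classical in
/-- `sin [A] = ι * e_C(π {A} / sgn {A})` if `A ∉ 𝔸`, and `sin [A] = 1` otherwise; here `ι` is the
chosen `(q-1)`-st root of `-1`. -/
def sinClass (π ι : Omega F) (c : RatFunc F ⧸ polySubgroup F) : Omega F :=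
  if c = 0 then 1
  else ι * latticeExp π
    (π * algebraMap (RatFunc F) (Omega F) (fracRep c / RatFunc.C (sgn (fracRep c))))

/-- The extension of `sin` to the free abelian group on `k / 𝔸`. -/
def sinHom (π ι : Omega F) (a : (RatFunc F ⧸ polySubgroup F) →₀ ℤ) : Omega F :=
  a.prod fun c n => sinClass π ι c ^ n

variable (F) in
theorem finite_monic_degree_lt (d : ℕ) : {A : F[X] | A.Monic ∧ A.natDegree < d}.Finite := by
  have : Finite (degreeLT F d) := Finite.of_equiv _ (degreeLTEquiv F d).toEquiv.symm
  refine (Set.toFinite (degreeLT F d : Set F[X])).subset fun A hA => ?_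
  exact mem_degreeLT.2 ((natDegree_lt_iff_degree_lt hA.1.ne_zero).1 hA.2)

variable (F) in
/-- The monic polynomials of degree less than `d`. -/
def monicBelow (d : ℕ) : Finset F[X] := (finite_monic_degree_lt F d).toFinset

/-- The symbol `[f / g]` for `f, g ∈ 𝔸`, as an element of the free abelian group on `k / 𝔸`. -/
def symb (f g : F[X]) : (RatFunc F ⧸ polySubgroup F) →₀ ℤ :=
  Finsupp.single (QuotientAddGroup.mk
    (algebraMap F[X] (RatFunc F) f / algebraMap F[X] (RatFunc F) g)) 1

/-- The element `𝐚_{PQ}` of the free abelian group on `k / 𝔸`. -/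
def aPQ (γ : Fˣ) (P Q : F[X]) : (RatFunc F ⧸ polySubgroup F) →₀ ℤ :=
  ∑ A ∈ monicBelow F Q.natDegree, ∑ B ∈ monicBelow F P.natDegree,
    ∑ s ∈ Finset.Icc 1 (Nat.card F - 2),
      (s : ℤ) • (symb (B * Q + C ((γ⁻¹ ^ s : Fˣ) : F) * A) (P * Q) -
        symb (A * P + C ((γ⁻¹ ^ s : Fˣ) : F) * B) (P * Q))

/-- The element `u_{PQ}`; `sqrt f` is the chosen square root of `f ∈ 𝔸` in `Ω`. -/
def uPQ (π ι : Omega F) (sqrt : F[X] → Omega F) (γ : Fˣ) (P Q : F[X]) : Omega F :=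
  if Even P.natDegree then
    if Even Q.natDegree then sinHom π ι (aPQ γ P Q)
    else sqrt P * sinHom π ι (aPQ γ P Q)
  else
    if Even Q.natDegree then sqrt Q * sinHom π ι (aPQ γ P Q)
    else sqrt (P * Q) * sinHom π ι (aPQ γ P Q)

/-- `K(θ)` as an extension of `k`; this is `K̃` when `θ` is a `(q-1)`-st root of `u_{PQ}`. -/
def quasiField (K : IntermediateField (RatFunc F) (Omega F)) (θ : Omega F) :
    IntermediateField (RatFunc F) (Omega F) :=
  (IntermediateField.adjoin K {θ}).restrictScalars (RatFunc F)

theorem le_quasiField (K : IntermediateField (RatFunc F) (Omega F)) (θ : Omega F) :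
    K ≤ quasiField K θ := fun x hx =>
  (IntermediateField.adjoin K {θ}).algebraMap_mem ⟨x, hx⟩

end Sine

section Groups

variable {k E : Type*} [Field k] [Field E] [Algebra k E] {K L : IntermediateField k E}

/-- `τ ∈ Gal(L/k)` is a lifting of `σ ∈ Gal(K/k)`: it restricts to `σ` on `K ⊆ L`. -/
def IsLift (h : K ≤ L) (τ : L ≃ₐ[k] L) (σ : K ≃ₐ[k] K) : Prop :=
  ∀ x : K, τ (IntermediateField.inclusion h x) = IntermediateField.inclusion h (σ x)

/-- The subgroup of `Gal(L/k)` of all liftings of the elements of a subgroup `H` of `Gal(K/k)`. -/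
def liftings (h : K ≤ L) (H : Subgroup (K ≃ₐ[k] K)) : Subgroup (L ≃ₐ[k] L) where
  carrier := {τ | ∃ σ ∈ H, IsLift h τ σ}
  one_mem' := ⟨1, H.one_mem, fun _ => rfl⟩
  mul_mem' := by
    rintro τ τ' ⟨σ, hσ, hτ⟩ ⟨σ', hσ', hτ'⟩
    refine ⟨σ * σ', H.mul_mem hσ hσ', fun x => ?_⟩
    rw [AlgEquiv.mul_apply, hτ' x, hτ (σ' x), AlgEquiv.mul_apply]
  inv_mem' := by
    rintro τ ⟨σ, hσ, hτ⟩
    refine ⟨σ⁻¹, H.inv_mem hσ, fun x => ?_⟩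
    have h1 := hτ (σ⁻¹ x)
    rw [← AlgEquiv.mul_apply σ, mul_inv_cancel, AlgEquiv.one_apply] at h1
    rw [← h1, ← AlgEquiv.mul_apply, inv_mul_cancel, AlgEquiv.one_apply]

end Groups

section Factors

variable {F : Type*} [Field F]

/-- The set `S_M` of monic prime factors of `M`. -/
def primeFactors (M : F[X]) : Set F[X] := {L | L.Monic ∧ Irreducible L ∧ L ∣ M}

/-- Let `L` be a monic prime factor of `M`, with exact power `L ^ r` in `M`. The unit `a` of `𝔸 / M`
lies in the factor `(𝔸 / L ^ r)^*` of `(𝔸 / M)^*` (it is `1` modulo the powers of the other prime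
factors of `M`), and there it lies in the subgroup of order `|L| - 1` complementary to
`(𝔸 / L ^ r)^{(1)}`, which is isomorphic to `(𝔸 / L)^*`, and it corresponds to a generator. -/
def IsFactorGenerator (M L : F[X]) (a : (F[X] ⧸ Ideal.span {M})ˣ) : Prop :=
  a ^ (Nat.card F ^ L.natDegree - 1) = 1 ∧
  ∃ g : F[X], Ideal.Quotient.mk (Ideal.span {M}) g = a ∧
    (∀ L' ∈ primeFactors M, L' ≠ L → ∀ m : ℕ, L' ^ m ∣ M → L' ^ m ∣ g - 1) ∧
    ∀ b : F[X], ¬ L ∣ b → ∃ n : ℕ, L ∣ g ^ n - b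

end Factors

end

end QuasiCyclotomic

open QuasiCyclotomic

/-!
# The Galois group of a quasi-cyclotomic function field

The isomorphism `Gal(K/k) ≃ (𝔸 / M)^*` comes from the Carlitz module. Over the complete
nonarchimedean field `Ω` the product defining `e_C` converges unconditionally; it is additive
because its partial products over the polynomials of bounded degree are multiples of polynomials
whose roots form a finite group, and its zeros are exactly `π𝔸` (`latticeExp_add`,
`latticeExp_eq_zero_iff`). Hence `e_C(a x) = C_a(e_C(x))` for explicit polynomials `C_a`
(`carlitzPoly`), the `M`-torsion points `e_C(a π / M)` are the `q ^ deg M` roots of the separable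
polynomial `C_M`, and `Gal(K/k)` embeds in `(𝔸 / M)^*`. It is the whole group by Dedekind's
argument for cyclotomic polynomials, with the congruence `C_L ≡ X ^ (q ^ deg L)` modulo a prime `L`
in place of the Frobenius congruence (`map_carlitzPoly_prime`, `minpoly_carlitzPoly_prime`).

For the group-theoretic part it is not needed that `K(θ)` is normal over `k`. What is used is that
`u ^ 2 = θ ^ (2(q - 1))` lies in the cyclotomic field of conductor `P Q`: the factors of `sin` at
the symbols `[f / (P Q)]` are multiples by `ι` of `P Q`-torsion points, `ι ^ 2 ∈ F`, and the square
roots disappear on squaring. An automorphism of `p`-power order corresponds to some `a ≡ 1` modulo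
`P` and `Q`, because `a ^ (p ^ e) - 1 = (a - 1) ^ (p ^ e)`, so it fixes `u ^ 2`
(`exists_sq_uPQ_fixed`). If `τ` fixes `x ^ (2(q - 1))`, then `τ ^ (2(q - 1))` fixes `x`
(`algEquiv_pow_apply_eq`), and `2(q - 1)` is prime to `p`. It follows that each element of
`p`-power order in `Gal(K/k)` has a lift of `p`-power order fixing `θ`
(`exists_lift_of_pow_eq_one`), that the elements of `p`-power order in `Gal(K(θ)/k)` fix all
conjugates of `θ` and hence are central (`mem_center_of_pow_eq_one`), and that none but the
identity lies in `Gal(K(θ)/K)`. So the Sylow subgroup of `Gal(K(θ)/k)` is central and maps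
isomorphically onto that of `Gal(K/k)`. The elements `σ_L` have orders prime to `p` and generate
`(𝔸 / M)^*` modulo the units that are `1` modulo each prime factor of `M`, which are `p`-elements
(`exists_mem_closure_pow_eq_one`); the direct product decomposition is then
`exists_sylow_prod_mulEquiv`.
-/

namespace QuasiCyclotomic

noncomputable section

/-! ### The Carlitz module -/

section CarlitzPolynomials

variable {F : Type*} [Field F] [Finite F]

theorem add_pow_natCard {R : Type*} [CommRing R] [Algebra F R] (x y : R) :
    (x + y) ^ Nat.card F = x ^ Nat.card F + y ^ Nat.card F := by
  have := Fintype.ofFinite F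
  simpa [FiniteField.coe_frobeniusAlgHom] using map_add (FiniteField.frobeniusAlgHom F R) x y

theorem pow_natCard (c : F) : c ^ Nat.card F = c := by
  have := Fintype.ofFinite F
  rw [Nat.card_eq_fintype_card, FiniteField.pow_card]

theorem algebraMap_pow_natCard {R : Type*} [CommRing R] [Algebra F R] (c : F) :
    algebraMap F R c ^ Nat.card F = algebraMap F R c := by
  rw [← map_pow, pow_natCard]

theorem sum_pow_natCard {R : Type*} [CommRing R] [Algebra F R] {ι : Type*} (s : Finset ι)
    (f : ι → R) : (∑ i ∈ s, f i) ^ Nat.card F = ∑ i ∈ s, f i ^ Nat.card F := by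
  have := Fintype.ofFinite F
  rw [Nat.card_eq_fintype_card]
  exact map_sum (FiniteField.frobeniusAlgHom F R) f s

theorem add_pow_natCard_pow {R : Type*} [CommRing R] [Algebra F R] (x y : R) (i : ℕ) :
    (x + y) ^ Nat.card F ^ i = x ^ Nat.card F ^ i + y ^ Nat.card F ^ i := by
  induction i with
  | zero => simp
  | succ i ih => rw [pow_succ, pow_mul, ih, add_pow_natCard (F := F), ← pow_mul, ← pow_mul]

variable (F) in
/-- The action `f ↦ T f + f ^ q` of `T` on `𝔸[X]` through the Carlitz module. -/
def carlitzEnd : Module.End F F[X][X] where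
  toFun f := C X * f + f ^ Nat.card F
  map_add' f g := by rw [add_pow_natCard (F := F)]; ring
  map_smul' c f := by
    rw [Algebra.smul_def, mul_pow, algebraMap_pow_natCard, RingHom.id_apply, Algebra.smul_def]
    ring

/-- The polynomial `C_a ∈ 𝔸[X]` by which `a ∈ 𝔸` acts through the Carlitz module, obtained by
letting `a` act on the generic point `X` of `𝔸[X]`. -/
def carlitzPoly (a : F[X]) : F[X][X] := aeval (carlitzEnd F) a X

theorem carlitzEnd_apply (f : F[X][X]) : carlitzEnd F f = C X * f + f ^ Nat.card F := rfl

theorem carlitzPoly_add (a b : F[X]) : carlitzPoly (a + b) = carlitzPoly a + carlitzPoly b := by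
  simp [carlitzPoly]

theorem carlitzPoly_C (c : F) : carlitzPoly (C c) = C (C c) * X := by
  simp [carlitzPoly, Module.algebraMap_end_apply, Algebra.smul_def]

@[simp] theorem carlitzPoly_one : carlitzPoly (1 : F[X]) = X := by
  simpa using carlitzPoly_C (1 : F)

@[simp] theorem carlitzPoly_zero : carlitzPoly (0 : F[X]) = 0 := by simp [carlitzPoly]

theorem carlitzPoly_X_mul (a : F[X]) :
    carlitzPoly (X * a) = C X * carlitzPoly a + carlitzPoly a ^ Nat.card F := by
  simp [carlitzPoly, carlitzEnd_apply]

theorem aeval_carlitzEnd (a : F[X]) (f : F[X][X]) :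
    aeval (carlitzEnd F) a f = (carlitzPoly a).comp f := by
  induction a using Polynomial.induction_on' with
  | add p q hp hq => simp [carlitzPoly_add, hp, hq]
  | monomial n c =>
    rw [← C_mul_X_pow_eq_monomial]
    induction n with
    | zero => simp [carlitzPoly_C, Module.algebraMap_end_apply, Algebra.smul_def]
    | succ n ih =>
      have h : C c * X ^ (n + 1) = X * (C c * X ^ n : F[X]) := by ring
      rw [h, carlitzPoly_X_mul, map_mul, Module.End.mul_apply, ih]
      simp [carlitzEnd_apply]

theorem carlitzPoly_mul (a b : F[X]) :
    carlitzPoly (a * b) = (carlitzPoly a).comp (carlitzPoly b) := by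
  rw [← aeval_carlitzEnd, carlitzPoly, map_mul, Module.End.mul_apply, ← carlitzPoly]

theorem carlitzPoly_X_mul_of_eq_sum (n : ℕ) (a : F[X]) (c : ℕ → F[X])
    (hc : carlitzPoly a = ∑ i ∈ Finset.range n, C (c i) * X ^ Nat.card F ^ i) :
    carlitzPoly (X * a) = (∑ i ∈ Finset.range n, C (X * c i) * X ^ Nat.card F ^ i) +
      ∑ i ∈ Finset.range n, C (c i ^ Nat.card F) * X ^ Nat.card F ^ (i + 1) := by
  rw [carlitzPoly_X_mul, hc, sum_pow_natCard (F := F), Finset.mul_sum]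
  refine congrArg₂ (· + ·) ?_ ?_
  · exact Finset.sum_congr rfl fun i _ => by rw [C_mul, mul_assoc]
  · exact Finset.sum_congr rfl fun i _ => by rw [mul_pow, C_pow, ← pow_mul, pow_succ]

/-- `C_a` is `F`-linear, with linear coefficient `a`; its leading coefficient is that of `a`. -/
theorem exists_carlitzPoly_eq_sum (n : ℕ) (a : F[X]) (ha : a.natDegree ≤ n) :
    ∃ c : ℕ → F[X], carlitzPoly a = ∑ i ∈ Finset.range (n + 1), C (c i) * X ^ Nat.card F ^ i ∧
      c 0 = a ∧ c n = C (a.coeff n) := by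
  induction n generalizing a with
  | zero =>
    rw [eq_C_of_natDegree_le_zero ha]
    exact ⟨fun _ => C (a.coeff 0), by simp [carlitzPoly_C], by simp, by simp⟩
  | succ n ih =>
    obtain ⟨c, hc, h0, hn⟩ := ih a.divX (by rw [natDegree_divX_eq_natDegree_tsub_one]; omega)
    have key : carlitzPoly a = C (C (a.coeff 0)) * X +
        ((∑ i ∈ Finset.range (n + 1), C (X * c i) * X ^ Nat.card F ^ i) +
        ∑ i ∈ Finset.range (n + 1), C (c i ^ Nat.card F) * X ^ Nat.card F ^ (i + 1)) := by
      rw [← carlitzPoly_X_mul_of_eq_sum _ _ _ hc, ← carlitzPoly_C, ← carlitzPoly_add, add_comm,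
        X_mul_divX_add]
    refine ⟨fun i => (if i = 0 then C (a.coeff 0) else c (i - 1) ^ Nat.card F) +
      if i ≤ n then X * c i else 0, ?_, ?_, ?_⟩
    · have e1 : ∑ i ∈ Finset.range (n + 1 + 1), C (if i = 0 then C (a.coeff 0) else
          c (i - 1) ^ Nat.card F) * X ^ Nat.card F ^ i = (∑ i ∈ Finset.range (n + 1),
            C (c i ^ Nat.card F) * X ^ Nat.card F ^ (i + 1)) + C (C (a.coeff 0)) * X := by
        rw [Finset.sum_range_succ']
        simp only [if_true, pow_zero, pow_one, add_tsub_cancel_right, Nat.succ_ne_zero, if_false]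
      have e2 : ∑ i ∈ Finset.range (n + 1 + 1), C (if i ≤ n then X * c i else 0) *
          X ^ Nat.card F ^ i = ∑ i ∈ Finset.range (n + 1), C (X * c i) * X ^ Nat.card F ^ i := by
        rw [Finset.sum_range_succ, if_neg (by omega), C_0, zero_mul, add_zero]
        exact Finset.sum_congr rfl fun i hi => by
          rw [if_pos (Nat.lt_succ_iff.1 (Finset.mem_range.1 hi))]
      simp only [C_add, add_mul, Finset.sum_add_distrib]
      rw [key, e1, e2, add_comm, add_assoc, add_comm]
    · simp only [if_true, Nat.zero_le, h0]
      rw [add_comm, X_mul_divX_add]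
    · simp [hn, ← C_pow, pow_natCard]

theorem carlitzPoly_monic_natDegree {a : F[X]} (ha : a.Monic) :
    (carlitzPoly a).Monic ∧ (carlitzPoly a).natDegree = Nat.card F ^ a.natDegree := by
  obtain ⟨c, hc, h0, hn⟩ := exists_carlitzPoly_eq_sum a.natDegree a le_rfl
  rw [Finset.sum_range_succ, hn, coeff_natDegree, ha, C_1, C_1, one_mul, add_comm] at hc
  have hlt : (∑ i ∈ Finset.range a.natDegree, C (c i) * X ^ Nat.card F ^ i).degree <
      ((Nat.card F ^ a.natDegree : ℕ) : WithBot ℕ) := by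
    rw [← mem_degreeLT]
    refine Submodule.sum_mem _ fun i hi => mem_degreeLT.2 ?_
    refine (degree_C_mul_X_pow_le _ _).trans_lt ?_
    exact_mod_cast Nat.pow_lt_pow_right (Finite.one_lt_card (α := F)) (Finset.mem_range.1 hi)
  have hm := monic_X_pow_add hlt
  refine ⟨hc ▸ hm, ?_⟩
  rw [hc, natDegree_eq_of_degree_eq_some]
  rw [degree_add_eq_left_of_degree_lt (by rwa [degree_X_pow]), degree_X_pow]

theorem derivative_carlitzPoly (a : F[X]) : derivative (carlitzPoly a) = C a := by
  obtain ⟨c, hc, h0, -⟩ := exists_carlitzPoly_eq_sum a.natDegree a le_rfl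
  have hq : ((Nat.card F : ℕ) : F[X]) = 0 := by
    have := Fintype.ofFinite F
    rw [← map_natCast (C : F →+* F[X]), Nat.card_eq_fintype_card, FiniteField.cast_card_eq_zero,
      C_0]
  rw [hc, Finset.sum_range_succ', derivative_add, derivative_sum, Finset.sum_eq_zero]
  · simp [h0]
  · intro i _
    rw [pow_succ, derivative_C_mul, derivative_X_pow, Nat.cast_mul, hq, mul_zero, C_0, zero_mul,
      mul_zero]

/-- Comparison of the coefficients in `C_T ∘ C_a = C_a ∘ C_T`. -/
theorem carlitz_coeff_rec {n : ℕ} {a : F[X]} {c : ℕ → F[X]}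
    (hc : carlitzPoly a = ∑ i ∈ Finset.range (n + 1), C (c i) * X ^ Nat.card F ^ i)
    {i : ℕ} (hi : i < n) :
    c (i + 1) * X ^ Nat.card F ^ (i + 1) + c i = X * c (i + 1) + c i ^ Nat.card F := by
  have h1 : carlitzPoly (a * X) = ∑ i ∈ Finset.range (n + 1),
      (C (c i * X ^ Nat.card F ^ i) * X ^ Nat.card F ^ i + C (c i) * X ^ Nat.card F ^ (i + 1)) := by
    rw [carlitzPoly_mul, hc, ← mul_one (X : F[X]), carlitzPoly_X_mul, Polynomial.sum_comp]
    refine Finset.sum_congr rfl fun i _ => ?_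
    rw [carlitzPoly_one, mul_comp, C_comp, X_pow_comp, add_pow_natCard_pow (F := F), mul_one]
    simp [mul_pow, ← pow_mul, ← pow_succ', mul_add, mul_assoc]
  have h2 : carlitzPoly (a * X) = ∑ i ∈ Finset.range (n + 1),
      (C (X * c i) * X ^ Nat.card F ^ i + C (c i ^ Nat.card F) * X ^ Nat.card F ^ (i + 1)) := by
    rw [mul_comm, carlitzPoly_X_mul, hc, sum_pow_natCard (F := F), Finset.mul_sum,
      ← Finset.sum_add_distrib]
    refine Finset.sum_congr rfl fun i _ => ?_
    rw [C_mul, mul_assoc, mul_pow, C_pow, ← pow_mul, pow_succ]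
  have hinj : ∀ i j : ℕ, Nat.card F ^ i = Nat.card F ^ j ↔ i = j := fun i j =>
    (Nat.pow_right_injective (Finite.one_lt_card (α := F))).eq_iff
  have h3 := congrArg (fun f => f.coeff (Nat.card F ^ (i + 1))) (h1.symm.trans h2)
  simp only [finsetSum_coeff, coeff_add, coeff_C_mul, coeff_X_pow, hinj, mul_ite, mul_one,
    mul_zero, Finset.sum_add_distrib, add_left_inj] at h3
  simpa [Finset.sum_ite_eq, hi, hi.le, Nat.lt_succ_of_lt hi] using h3

/-- `C_L ≡ X ^ (q ^ d)` modulo a monic prime `L` of degree `d`. -/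
theorem map_carlitzPoly_prime {L : F[X]} (hL : L.Monic) (hirr : Irreducible L) :
    (carlitzPoly L).map (Ideal.Quotient.mk (Ideal.span {L})) =
      X ^ Nat.card F ^ L.natDegree := by
  obtain ⟨c, hc, h0, hn⟩ := exists_carlitzPoly_eq_sum L.natDegree L le_rfl
  have hdvd : ∀ i < L.natDegree, L ∣ c i := by
    intro i
    induction i with
    | zero => intro _; rw [h0]
    | succ i ih =>
      intro hi
      have hi' := ih (by omega)
      have hrec := carlitz_coeff_rec hc (i := i) (by omega)
      have h1 : c (i + 1) * (X ^ Nat.card F ^ (i + 1) - X) = c i ^ Nat.card F - c i := by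
        linear_combination hrec
      have h2 : L ∣ c (i + 1) * (X ^ Nat.card F ^ (i + 1) - X) := by
        rw [h1]
        exact dvd_sub (dvd_pow hi' Nat.card_pos.ne') hi'
      refine (hirr.prime.dvd_or_dvd h2).resolve_right fun h3 => ?_
      exact Nat.not_dvd_of_pos_of_lt i.succ_pos hi
        (hirr.natDegree_dvd_of_dvd_X_pow_card_pow_sub_X h3)
  rw [hc, Finset.sum_range_succ, Polynomial.map_add, Polynomial.map_sum, Finset.sum_eq_zero]
  · rw [hn, coeff_natDegree, hL]; simp
  · intro i hi
    rw [Polynomial.map_mul, map_C, (Ideal.Quotient.eq_zero_iff_mem).2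
      (Ideal.mem_span_singleton.2 (hdvd i (Finset.mem_range.1 hi))), C_0, zero_mul]

end CarlitzPolynomials

/-! ### Irreducibility of the Carlitz cyclotomic polynomials -/

section Irreducibility

variable {F : Type*} [Field F] [Finite F]

theorem natCard_quotient_span {L : F[X]} (hL : Irreducible L) :
    Finite (F[X] ⧸ Ideal.span {L}) ∧
      Nat.card (F[X] ⧸ Ideal.span {L}) = Nat.card F ^ L.natDegree := by
  have h : Module.Finite F (AdjoinRoot L) := (AdjoinRoot.powerBasis hL.ne_zero).finite
  have h' : Module.finrank F (AdjoinRoot L) = L.natDegree := by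
    rw [(AdjoinRoot.powerBasis hL.ne_zero).finrank, AdjoinRoot.powerBasis_dim]
  have hf : Finite (AdjoinRoot L) := Module.finite_of_finite F
  exact ⟨hf, by rw [← h']; exact Module.natCard_eq_pow_finrank (K := F) (V := AdjoinRoot L)⟩

variable {S : Type*} [Field S] [Algebra F[X] S]

theorem aeval_carlitzPoly_mul (a b : F[X]) (x : S) :
    aeval x (carlitzPoly (a * b)) = aeval (aeval x (carlitzPoly b)) (carlitzPoly a) := by
  rw [carlitzPoly_mul, aeval_comp]

theorem aeval_carlitzPoly_eq_zero_of_dvd {M N : F[X]} (h : M ∣ N) {x : S}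
    (hx : aeval x (carlitzPoly M) = 0) : aeval x (carlitzPoly N) = 0 := by
  obtain ⟨b, rfl⟩ := h
  rw [mul_comm, aeval_carlitzPoly_mul, hx]
  obtain ⟨c, hc, -, -⟩ := exists_carlitzPoly_eq_sum b.natDegree b le_rfl
  simp [hc, zero_pow (pow_pos (Nat.card_pos (α := F)) _).ne']

theorem isIntegral_of_carlitzPoly {M : F[X]} (hM : M.Monic) {x : S}
    (hx : aeval x (carlitzPoly M) = 0) : IsIntegral F[X] x :=
  ⟨carlitzPoly M, (carlitzPoly_monic_natDegree hM).1, hx⟩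

variable [Module.IsTorsionFree F[X] S]

/-- Dedekind's argument: the conjugates over `k` of an `M`-torsion point of the Carlitz module are
permuted by the action of a prime `L ∤ M`, since `C_L` reduces modulo `L` to the Frobenius of
`𝔸 / L`, while `C_M` stays separable modulo `L`. -/
theorem minpoly_carlitzPoly_prime {M L : F[X]} (hM : M.Monic) (hL : L.Monic)
    (hirr : Irreducible L) (hLM : ¬ L ∣ M) {x : S} (hx : aeval x (carlitzPoly M) = 0) :
    minpoly F[X] x = minpoly F[X] (aeval x (carlitzPoly L)) := by
  have hy : aeval (aeval x (carlitzPoly L)) (carlitzPoly M) = 0 := by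
    rw [← aeval_carlitzPoly_mul]
    exact aeval_carlitzPoly_eq_zero_of_dvd (dvd_mul_right _ _) hx
  have ix := isIntegral_of_carlitzPoly hM hx
  have iy := isIntegral_of_carlitzPoly hM hy
  by_contra hdiff
  set f := minpoly F[X] x with hf
  set g := minpoly F[X] (aeval x (carlitzPoly L)) with hg
  have fmonic : f.Monic := minpoly.monic ix
  have gmonic : g.Monic := minpoly.monic iy
  have firr : Irreducible f := minpoly.irreducible ix
  have girr : Irreducible g := minpoly.irreducible iy
  -- distinct conjugacy classes of roots give coprime factors of `C_M`
  have prod : f * g ∣ carlitzPoly M := by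
    obtain ⟨h, hh⟩ := minpoly.isIntegrallyClosed_dvd ix hx
    have h1 : g ∣ f * h := hh ▸ minpoly.isIntegrallyClosed_dvd iy hy
    have h2 : g ∣ h := (girr.prime.dvd_or_dvd h1).resolve_left fun h3 =>
      hdiff (eq_of_monic_of_associated fmonic gmonic
        (associated_of_dvd_dvd (girr.dvd_symm firr h3) h3))
    rw [hh]
    exact mul_dvd_mul_left _ h2
  have hmax : (Ideal.span {L}).IsMaximal := PrincipalIdealRing.isMaximal_of_irreducible hirr
  let : Field (F[X] ⧸ Ideal.span {L}) := Ideal.Quotient.field _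
  obtain ⟨hfin, hcard⟩ := natCard_quotient_span hirr
  have := Fintype.ofFinite (F[X] ⧸ Ideal.span {L})
  set r := Ideal.Quotient.mk (Ideal.span {L}) with hr
  have hdvd : f.map r ∣ g.map r ^ Nat.card F ^ L.natDegree := by
    have h1 : f ∣ g.comp (carlitzPoly L) := minpoly.isIntegrallyClosed_dvd ix (by
      rw [aeval_comp]; exact minpoly.aeval _ _)
    have h2 := _root_.map_dvd (mapRingHom r) h1
    rw [coe_mapRingHom, map_comp, map_carlitzPoly_prime hL hirr, ← expand_eq_comp_X_pow,
      ← hcard, Nat.card_eq_fintype_card, FiniteField.expand_card] at h2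
    rwa [← hcard, Nat.card_eq_fintype_card]
  have hsep : ((carlitzPoly M).map r).Separable := by
    have hMr : r M ≠ 0 := fun h => hLM
      (Ideal.mem_span_singleton.1 (Ideal.Quotient.eq_zero_iff_mem.1 h))
    refine (separable_def _).2 ⟨0, C (r M)⁻¹, ?_⟩
    rw [derivative_map, derivative_carlitzPoly, map_C, ← C_mul, inv_mul_cancel₀ hMr]
    simp
  have prod' : f.map r * g.map r ∣ (carlitzPoly M).map r := by
    simpa using _root_.map_dvd (mapRingHom r) prod
  have hcop : IsCoprime (f.map r) (g.map r) := (hsep.of_dvd prod').isCoprime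
  -- `f` is prime to `g` modulo `L`, and yet it divides a power of `g`, so it is a constant
  have hunit := (hcop.pow_right (n := Nat.card F ^ L.natDegree)).isUnit_of_dvd' dvd_rfl hdvd
  have h0 := natDegree_eq_zero_of_isUnit hunit
  rw [fmonic.natDegree_map] at h0
  exact (minpoly.natDegree_pos ix).ne' h0

theorem minpoly_carlitzPoly_of_coprime {M : F[X]} (hM : M.Monic) {x : S}
    (hx : aeval x (carlitzPoly M) = 0) {a : F[X]} (ha : a.Monic) (hcop : IsCoprime a M) :
    minpoly F[X] x = minpoly F[X] (aeval x (carlitzPoly a)) := by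
  induction hn : a.natDegree using Nat.strong_induction_on generalizing a with
  | _ n ih =>
    by_cases hu : IsUnit a
    · rw [ha.eq_one_of_isUnit hu]; simp
    obtain ⟨L, hL, hirr, b, rfl⟩ := exists_monic_irreducible_factor a hu
    have hb : b.Monic := hL.of_mul_monic_left ha
    have hLM : ¬ L ∣ M := fun h => hirr.not_isUnit
      (hcop.of_mul_left_left.isUnit_of_dvd' dvd_rfl h)
    have hd : b.natDegree < n := by
      rw [← hn, hL.natDegree_mul hb]
      have := hirr.natDegree_pos
      omega
    rw [ih _ hd hb hcop.of_mul_left_right rfl, aeval_carlitzPoly_mul]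
    refine minpoly_carlitzPoly_prime hM hL hirr hLM ?_
    rw [← aeval_carlitzPoly_mul]
    exact aeval_carlitzPoly_eq_zero_of_dvd (dvd_mul_right _ _) hx

end Irreducibility

/-! ### Infinite products, additive polynomials and the absolute value of `Ω` -/

section InfiniteProducts

open Filter Topology

variable {K ι : Type*} [NormedField K] [IsUltrametricDist K]

/-- The ultrametric estimate behind the convergence of `∏ (1 + g i)`: no summability of norms is
needed. -/
theorem norm_prod_one_add_sub_one_le {g : ι → K} {δ : ℝ} (h0 : 0 ≤ δ) (h1 : δ ≤ 1) (s : Finset ι)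
    (hs : ∀ i ∈ s, ‖g i‖ ≤ δ) : ‖∏ i ∈ s, (1 + g i) - 1‖ ≤ δ := by
  classical
  induction s using Finset.induction_on with
  | empty => simpa
  | insert a s ha ih =>
    have hP := ih fun i hi => hs i (Finset.mem_insert_of_mem hi)
    have hP1 : ‖∏ i ∈ s, (1 + g i)‖ ≤ 1 := by
      have := IsUltrametricDist.norm_add_le_max (∏ i ∈ s, (1 + g i) - 1) 1
      rw [sub_add_cancel, norm_one] at this
      exact this.trans (max_le (hP.trans h1) le_rfl)
    rw [Finset.prod_insert ha]
    have e : (1 + g a) * ∏ i ∈ s, (1 + g i) - 1 =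
        (∏ i ∈ s, (1 + g i) - 1) + g a * ∏ i ∈ s, (1 + g i) := by ring
    rw [e]
    refine (IsUltrametricDist.norm_add_le_max _ _).trans (max_le hP ?_)
    rw [norm_mul]
    calc _ ≤ δ * 1 := mul_le_mul (hs a (Finset.mem_insert_self _ _)) hP1 (norm_nonneg _) h0
      _ = δ := mul_one δ

omit [IsUltrametricDist K] in
theorem exists_finset_norm_le {g : ι → K} (hg : Tendsto g cofinite (𝓝 0)) {δ : ℝ} (hδ : 0 < δ) :
    ∃ s : Finset ι, ∀ i ∉ s, ‖g i‖ ≤ δ := by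
  have h := (tendsto_zero_iff_norm_tendsto_zero.1 hg).eventually (gt_mem_nhds hδ)
  refine ⟨(eventually_cofinite.1 h).toFinset, fun i hi => not_lt.1 fun hlt => hi ?_⟩
  exact (Set.Finite.mem_toFinset _).2 hlt.not_gt

theorem multipliable_one_add_of_tendsto_cofinite [CompleteSpace K] {g : ι → K}
    (hg : Tendsto g cofinite (𝓝 0)) : Multipliable fun i => 1 + g i := by
  classical
  suffices h : CauchySeq fun s : Finset ι => ∏ i ∈ s, (1 + g i) by
    obtain ⟨a, ha⟩ := cauchySeq_tendsto_of_complete h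
    exact ⟨a, by simpa [HasProd] using ha⟩
  rw [Metric.cauchySeq_iff']
  intro ε hε
  obtain ⟨s₁, h₁⟩ := exists_finset_norm_le hg one_pos
  set B := ‖∏ i ∈ s₁, (1 + g i)‖ with hB
  -- outside `s₁` the partial products have norm at most `1`, so all those over sets that contain
  -- `s₁` are bounded by `B`; outside `s₂` they differ from `1` by at most `ε / (2 (B + 1))`
  have hδ : 0 < min 1 (ε / (2 * (B + 1))) := lt_min one_pos (by positivity)
  obtain ⟨s₂, h₂⟩ := exists_finset_norm_le hg hδ
  refine ⟨s₁ ∪ s₂, fun s hs => ?_⟩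
  have hle : ‖∏ i ∈ s₁ ∪ s₂, (1 + g i)‖ ≤ B := by
    rw [← Finset.prod_sdiff Finset.subset_union_left, norm_mul]
    have h3 := norm_prod_one_add_sub_one_le (g := g) zero_le_one le_rfl ((s₁ ∪ s₂) \ s₁)
      fun i hi => h₁ i (Finset.mem_sdiff.1 hi).2
    have h4 := IsUltrametricDist.norm_add_le_max (∏ i ∈ (s₁ ∪ s₂) \ s₁, (1 + g i) - 1) 1
    rw [sub_add_cancel, norm_one] at h4
    exact mul_le_of_le_one_left (norm_nonneg _) (h4.trans (max_le h3 le_rfl))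
  have h5 := norm_prod_one_add_sub_one_le (g := g) hδ.le (min_le_left _ _) (s \ (s₁ ∪ s₂))
    fun i hi => h₂ i fun h => (Finset.mem_sdiff.1 hi).2 (Finset.mem_union_right _ h)
  rw [dist_eq_norm, ← Finset.prod_sdiff hs, ← sub_one_mul, norm_mul]
  calc _ ≤ ε / (2 * (B + 1)) * B :=
        mul_le_mul (h5.trans (min_le_right _ _)) hle (norm_nonneg _) (by positivity)
    _ < ε := by
      rw [div_mul_eq_mul_div, div_lt_iff₀ (by positivity)]
      nlinarith [norm_nonneg (∏ i ∈ s₁, (1 + g i))]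

theorem tprod_one_add_ne_zero [CompleteSpace K] {g : ι → K} (hg : Tendsto g cofinite (𝓝 0))
    (h0 : ∀ i, 1 + g i ≠ 0) : ∏' i, (1 + g i) ≠ 0 := by
  classical
  have hp := (multipliable_one_add_of_tendsto_cofinite hg).hasProd
  have hp' : Tendsto (fun s : Finset ι => ∏ i ∈ s, (1 + g i)) atTop (𝓝 (∏' i, (1 + g i))) := by
    simpa [HasProd] using hp
  obtain ⟨s₁, h₁⟩ := exists_finset_norm_le hg (one_half_pos (α := ℝ))
  have hlow : ∀ᶠ s : Finset ι in atTop, ‖∏ i ∈ s₁, (1 + g i)‖ ≤ ‖∏ i ∈ s, (1 + g i)‖ := by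
    filter_upwards [eventually_ge_atTop s₁] with s hs
    rw [← Finset.prod_sdiff hs, norm_mul]
    have h3 := norm_prod_one_add_sub_one_le (g := g) one_half_pos.le one_half_lt_one.le (s \ s₁)
      fun i hi => h₁ i (Finset.mem_sdiff.1 hi).2
    have h4 := IsUltrametricDist.norm_add_le_max (∏ i ∈ s \ s₁, (1 + g i))
      (1 - ∏ i ∈ s \ s₁, (1 + g i))
    rw [add_sub_cancel, norm_one, norm_sub_rev, le_max_iff] at h4
    refine le_mul_of_one_le_left (norm_nonneg _) (h4.resolve_right fun h => ?_)
    linarith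
  have h6 := ge_of_tendsto hp'.norm hlow
  rw [← norm_pos_iff]
  exact (norm_pos_iff.2 (Finset.prod_ne_zero_iff.2 fun i _ => h0 i)).trans_le h6

end InfiniteProducts

section AdditivePolynomials

variable {K : Type*} [Field K]

/-- The monic polynomial whose roots form a finite subgroup `W` is additive: for fixed `y` the
polynomial `f (X + y) - f X - f y` has degree less than `|W|` and vanishes on `W`. -/
theorem prod_add_sub_of_subgroup (W : Finset K) (h0 : 0 ∈ W)
    (hsub : ∀ w ∈ W, ∀ z ∈ W, w - z ∈ W) (x y : K) :
    ∏ w ∈ W, (x + y - w) = ∏ w ∈ W, (x - w) + ∏ w ∈ W, (y - w) := by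
  have hshift : ∀ z ∈ W, ∀ y, ∏ w ∈ W, (z + y - w) = ∏ w ∈ W, (y - w) := fun z hz y =>
    Finset.prod_nbij' (fun w => w - z) (fun w => w + z) (fun w hw => hsub w hw z hz)
      (fun w hw => by simpa using hsub w hw (-z) (by simpa using hsub 0 h0 z hz))
      (by simp) (by simp) (fun w _ => by ring)
  set f : K[X] := ∏ w ∈ W, (X - C w) with hf
  have hev : ∀ t, f.eval t = ∏ w ∈ W, (t - w) := fun t => by simp [hf, eval_prod]
  have hm : f.Monic := monic_prod_of_monic _ _ fun w _ => monic_X_sub_C w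
  have hd : f.natDegree = W.card := by simp [hf]
  have hc : (f.comp (X + C y)).Monic := hm.comp_X_add_C y
  have hdc : (f.comp (X + C y)).natDegree = W.card := by simp [natDegree_comp, hd]
  have hpos : 0 < W.card := Finset.card_pos.2 ⟨0, h0⟩
  have hr : f.comp (X + C y) - f - C (f.eval y) = 0 := by
    refine eq_zero_of_natDegree_lt_card_of_eval_eq_zero' _ W (fun w hw => ?_) ?_
    · rw [eval_sub, eval_sub, eval_comp, eval_add, eval_X, eval_C, eval_C, hev, hev, hev,
        hshift w hw, Finset.prod_eq_zero hw (sub_self w)]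
      ring
    · have h1 : (f.comp (X + C y) - f).natDegree < W.card := by
        by_cases h : f.comp (X + C y) - f = 0
        · rwa [h, natDegree_zero]
        rw [natDegree_lt_iff_degree_lt h]
        have h2 := degree_sub_lt_left (p := f.comp (X + C y)) (q := f)
          (by rw [degree_eq_natDegree hc.ne_zero, degree_eq_natDegree hm.ne_zero, hd, hdc])
          hc.ne_zero (by rw [hc.leadingCoeff, hm.leadingCoeff])
        rwa [degree_eq_natDegree hc.ne_zero, hdc] at h2
      exact (natDegree_sub_le _ _).trans_lt (max_lt h1 (by rwa [natDegree_C]))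
  have h3 := congrArg (eval x) hr
  rw [eval_sub, eval_sub, eval_comp, eval_add, eval_X, eval_C, eval_C, eval_zero, hev, hev,
    hev] at h3
  linear_combination h3

end AdditivePolynomials

section NormOnOmega

variable {F : Type*} [Field F] [Finite F]

instance : Algebra F[X] (Omega F) := (polyMap (F := F)).toAlgebra

instance : Algebra F (Omega F) := ((polyMap (F := F)).comp C).toAlgebra

instance : IsScalarTower F F[X] (Omega F) := IsScalarTower.of_algebraMap_eq fun _ => rfl

instance : IsScalarTower F[X] (RatFunc F) (Omega F) := IsScalarTower.of_algebraMap_eq fun _ => rfl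

instance : IsScalarTower F (RatFunc F) (Omega F) := IsScalarTower.of_algebraMap_eq fun c => by
  rw [IsScalarTower.algebraMap_apply F F[X] (RatFunc F), ← IsScalarTower.algebraMap_apply F[X]]
  rfl

theorem polyMap_injective : Function.Injective (polyMap (F := F)) :=
  (algebraMap (RatFunc F) (Omega F)).injective.comp (RatFunc.algebraMap_injective F)

instance : Module.IsTorsionFree F[X] (Omega F) :=
  Module.isTorsionFree_iff_algebraMap_injective.2 polyMap_injective

theorem norm_algebraMap_const {c : F} (hc : c ≠ 0) : ‖algebraMap F (Omega F) c‖ = 1 := by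
  have := Fintype.ofFinite F
  have h : ‖algebraMap F (Omega F) c‖ ^ (Fintype.card F - 1) = 1 := by
    rw [← norm_pow, ← map_pow, FiniteField.pow_card_sub_one_eq_one c hc, map_one, norm_one]
  have hq := Fintype.one_lt_card (α := F)
  exact (pow_eq_one_iff_of_nonneg (norm_nonneg _) (by omega)).1 h

/-- In positive characteristic the integers are `0` or roots of unity, so have norm at most `1`. -/
instance : IsUltrametricDist (Omega F) := by
  refine IsUltrametricDist.isUltrametricDist_of_forall_norm_natCast_le_one fun n => ?_
  rw [← map_natCast (algebraMap F (Omega F))]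
  by_cases h : (n : F) = 0
  · rw [h, map_zero, norm_zero]; exact zero_le_one
  · rw [norm_algebraMap_const h]

open scoped Classical in
theorem one_lt_norm_polyMap_X : 1 < ‖polyMap (F := F) X‖ := by
  have h1 : ‖polyMap (F := F) X‖ = ‖(algebraMap (RatFunc F) (KInf F) RatFunc.X)‖ := by
    have h2 : polyMap (F := F) X = ofKInfBar F (algebraMap (KInf F) (KInfBar F)
        (algebraMap (RatFunc F) (KInf F) RatFunc.X)) := by
      rw [← RatFunc.algebraMap_X]; rfl
    rw [h2]
    refine (UniformSpace.Completion.norm_coe _).trans ?_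
    exact spectralNorm_extends _
  rw [h1]
  refine Valued.toNormedField.one_lt_norm_iff.2 ?_
  have h : Valued.v (algebraMap (RatFunc F) (KInf F) RatFunc.X) =
      (WithZero.exp 1 : WithZero (Multiplicative ℤ)) := by
    let := RatFunc.inftyValued F
    refine Eq.trans ?_ (RatFunc.inftyValuation.X F)
    exact Valued.valuedCompletion_apply _
  rw [h, ← WithZero.exp_zero]
  exact WithZero.exp_lt_exp.2 zero_lt_one

theorem norm_polyMap {a : F[X]} (ha : a ≠ 0) :
    ‖polyMap a‖ = ‖polyMap (F := F) X‖ ^ a.natDegree := by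
  induction hn : a.natDegree generalizing a with
  | zero =>
    have hc : a.coeff 0 ≠ 0 := fun h => ha (by rw [eq_C_of_natDegree_eq_zero hn, h, C_0])
    rw [eq_C_of_natDegree_eq_zero hn, pow_zero]
    exact norm_algebraMap_const hc
  | succ n ih =>
    have hd : a.divX.natDegree = n := by rw [natDegree_divX_eq_natDegree_tsub_one, hn]; rfl
    have hne : a.divX ≠ 0 := fun h => by
      rw [divX_eq_zero_iff] at h
      rw [h, natDegree_C] at hn
      omega
    have h1 : ‖polyMap (X * a.divX)‖ = ‖polyMap (F := F) X‖ ^ (n + 1) := by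
      rw [map_mul, norm_mul, ih hne hd, pow_succ']
    have h2 : ‖polyMap (C (a.coeff 0))‖ ≤ 1 := by
      by_cases h : a.coeff 0 = 0
      · rw [h, C_0, map_zero, norm_zero]; exact zero_le_one
      · exact (norm_algebraMap_const h).le
    have h3 : 1 < ‖polyMap (X * a.divX)‖ := h1 ▸ one_lt_pow₀ one_lt_norm_polyMap_X n.succ_ne_zero
    conv_lhs => rw [← X_mul_divX_add a, map_add]
    rw [IsUltrametricDist.norm_add_eq_max_of_norm_ne_norm (h2.trans_lt h3).ne',
      max_eq_left (h2.trans h3.le), h1]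

end NormOnOmega

/-! ### The Carlitz exponential -/

section CarlitzExponential

open Filter Topology

variable {F : Type*} [Field F] [Finite F]

theorem finite_degree_lt (d : ℕ) : {a : F[X] | a.degree < d}.Finite := by
  have : Finite (degreeLT F d) := Finite.of_equiv _ (degreeLTEquiv F d).toEquiv.symm
  exact (Set.toFinite (degreeLT F d : Set F[X])).subset fun a ha => mem_degreeLT.2 ha

theorem tendsto_latticeExp_factor (π x : Omega F) :
    Tendsto (fun a : {a : F[X] // a ≠ 0} => -(x / (π * polyMap a.1))) cofinite (𝓝 0) := by
  rw [tendsto_zero_iff_norm_tendsto_zero, NormedAddGroup.tendsto_nhds_zero]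
  intro ε hε
  obtain ⟨n, hn⟩ := pow_unbounded_of_one_lt (‖x / π‖ / ε) (one_lt_norm_polyMap_X (F := F))
  have hfin := (finite_degree_lt (F := F) n).preimage
    (Subtype.val_injective (p := fun a : F[X] => a ≠ 0)).injOn
  refine eventually_cofinite.2 (hfin.subset fun a ha => ?_)
  by_contra hlt
  apply ha
  have hdeg : n ≤ a.1.natDegree := by
    by_contra h
    exact hlt ((natDegree_lt_iff_degree_lt a.2).1 (not_le.1 h))
  have hT := pow_le_pow_right₀ (one_lt_norm_polyMap_X (F := F)).le hdeg
  rw [norm_norm, norm_neg, ← div_div, norm_div, norm_polyMap a.2, div_lt_comm₀ _ hε]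
  · exact hn.trans_le hT
  · exact pow_pos (zero_lt_one.trans one_lt_norm_polyMap_X) _

theorem multipliable_latticeExp (π x : Omega F) :
    Multipliable fun a : {a : F[X] // a ≠ 0} => 1 - x / (π * polyMap a.1) := by
  simpa only [← sub_eq_add_neg] using
    multipliable_one_add_of_tendsto_cofinite (tendsto_latticeExp_factor π x)

theorem latticeExp_eq_zero_iff {π : Omega F} (hπ : π ≠ 0) (x : Omega F) :
    latticeExp π x = 0 ↔ ∃ a : F[X], x = π * polyMap a := by
  constructor
  · intro h
    rcases mul_eq_zero.1 h with h | h
    · exact ⟨0, by simp [h]⟩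
    by_contra hne
    simp only [sub_eq_add_neg] at h
    refine tprod_one_add_ne_zero (tendsto_latticeExp_factor π x) (fun a ha => hne ⟨a.1, ?_⟩) h
    have ha' : π * polyMap a.1 ≠ 0 :=
      mul_ne_zero hπ ((map_ne_zero_iff _ polyMap_injective).2 a.2)
    rw [← sub_eq_add_neg, sub_eq_zero, eq_comm, div_eq_one_iff_eq ha'] at ha
    exact ha
  · rintro ⟨a, rfl⟩
    by_cases ha : a = 0
    · simp [latticeExp, ha]
    have ha' : π * polyMap a ≠ 0 := mul_ne_zero hπ ((map_ne_zero_iff _ polyMap_injective).2 ha)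
    rw [latticeExp, tprod_of_exists_eq_zero ⟨⟨a, ha⟩, by rw [div_self ha', sub_self]⟩, mul_zero]

theorem latticeExp_const_mul (π x : Omega F) (c : F) :
    latticeExp π (polyMap (C c) * x) = polyMap (C c) * latticeExp π x := by
  by_cases hc : c = 0
  · simp [latticeExp, hc]
  have hC : polyMap (C c) ≠ 0 := (map_ne_zero_iff _ polyMap_injective).2 (by simpa)
  rw [latticeExp, latticeExp, mul_assoc]
  congr 2
  let e : {a : F[X] // a ≠ 0} ≃ {a : F[X] // a ≠ 0} :=
    { toFun := fun a => ⟨C c * a.1, mul_ne_zero (by simpa) a.2⟩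
      invFun := fun a => ⟨C c⁻¹ * a.1, mul_ne_zero (by simpa) a.2⟩
      left_inv := fun a => Subtype.ext (by simp [← mul_assoc, ← C_mul, hc])
      right_inv := fun a => Subtype.ext (by simp [← mul_assoc, ← C_mul, hc]) }
  rw [← e.tprod_eq]
  refine tprod_congr fun a => ?_
  change 1 - _ / (π * polyMap (C c * a.1)) = _
  rw [map_mul, mul_left_comm, mul_div_mul_left _ _ hC]

/-- The partial products over the polynomials of degree less than `d` are multiples of the
polynomials with roots `π a`, `deg a < d`, which are additive. -/
theorem latticeExp_add {π : Omega F} (hπ : π ≠ 0) (x y : Omega F) :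
    latticeExp π (x + y) = latticeExp π x + latticeExp π y := by
  classical
  have hfin : ∀ d : ℕ, {a : {a : F[X] // a ≠ 0} | a.1.degree < d}.Finite := fun d =>
    (finite_degree_lt d).preimage Subtype.val_injective.injOn
  set D : ℕ → Finset {a : F[X] // a ≠ 0} := fun d => (hfin d).toFinset with hD
  have hmem : ∀ d a, a ∈ D d ↔ a.1.degree < d := fun d a => by simp [hD]
  have hDtop : Tendsto D atTop atTop := by
    refine tendsto_atTop_finset_of_monotone (fun d d' h a ha => ?_) fun a => ?_
    · exact (hmem _ _).2 (((hmem _ _).1 ha).trans_le (by exact_mod_cast h))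
    · exact ⟨a.1.natDegree + 1, (hmem _ _).2 (degree_lt_iff_coeff_zero _ _ |>.2 fun m hm =>
        coeff_eq_zero_of_natDegree_lt hm)⟩
  have hlim : ∀ x, Tendsto (fun d => x * ∏ a ∈ D d, (1 - x / (π * polyMap a.1))) atTop
      (𝓝 (latticeExp π x)) := fun x => by
    have h := (multipliable_latticeExp π x).hasProd
    rw [HasProd, SummationFilter.unconditional_filter] at h
    exact (h.comp hDtop).const_mul x
  refine tendsto_nhds_unique (hlim (x + y)) ?_
  refine ((hlim x).add (hlim y)).congr fun d => ?_
  have hinj : Function.Injective fun a : F[X] => π * polyMap a := fun a b h =>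
    polyMap_injective (mul_left_cancel₀ hπ h)
  set W : Finset (Omega F) := (finite_degree_lt (F := F) d).toFinset.image fun a => π * polyMap a
    with hW
  have hmemW : ∀ w, w ∈ W ↔ ∃ a : F[X], a.degree < d ∧ π * polyMap a = w := by simp [hW]
  have key : ∀ x, x * ∏ a ∈ D d, (1 - x / (π * polyMap a.1)) =
      (∏ a ∈ D d, (-(π * polyMap a.1))⁻¹) * ∏ w ∈ W, (x - w) := fun x => by
    have h0 : (0 : F[X]) ∈ (finite_degree_lt (F := F) d).toFinset := by simp
    have himg : (D d).map (Function.Embedding.subtype _) =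
        (finite_degree_lt (F := F) d).toFinset.erase 0 := by
      ext a
      simp [hmem, and_comm]
    rw [hW, Finset.prod_image hinj.injOn, ← Finset.mul_prod_erase _ _ h0, ← himg,
      Finset.prod_map, map_zero, mul_zero, sub_zero, mul_left_comm, ← Finset.prod_mul_distrib]
    congr 1
    refine Finset.prod_congr rfl fun a _ => ?_
    have ha' : π * polyMap a.1 ≠ 0 :=
      mul_ne_zero hπ ((map_ne_zero_iff _ polyMap_injective).2 a.2)
    change _ = (-(π * polyMap a.1))⁻¹ * (x - π * polyMap a.1)
    generalize π * polyMap a.1 = w at ha' ⊢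
    field_simp
    ring
  rw [key, key, key, prod_add_sub_of_subgroup W, mul_add]
  · exact (hmemW 0).2 ⟨0, by simp, by simp⟩
  · intro w hw z hz
    obtain ⟨a, ha, rfl⟩ := (hmemW w).1 hw
    obtain ⟨b, hb, rfl⟩ := (hmemW z).1 hz
    exact (hmemW _).2 ⟨a - b, (degree_sub_le _ _).trans_lt (max_lt ha hb), by
      rw [map_sub, mul_sub]⟩

/-- The exponential intertwines multiplication by `a` with the Carlitz action of `a`. -/
theorem latticeExp_polyMap_mul {π : Omega F} (hπ : IsCarlitzPeriod π) (a : F[X]) (x : Omega F) :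
    latticeExp π (polyMap a * x) = aeval (latticeExp π x) (carlitzPoly a) := by
  induction a using Polynomial.induction_on' with
  | add p q hp hq => rw [map_add, add_mul, latticeExp_add hπ.1, hp, hq, carlitzPoly_add, map_add]
  | monomial n c =>
    rw [← C_mul_X_pow_eq_monomial]
    induction n with
    | zero =>
      rw [pow_zero, mul_one, latticeExp_const_mul, carlitzPoly_C, map_mul, aeval_C, aeval_X]
      rfl
    | succ n ih =>
      have h : C c * X ^ (n + 1) = X * (C c * X ^ n : F[X]) := by ring
      rw [h, map_mul, mul_assoc, hπ.2, ih, carlitzPoly_X_mul, map_add, map_mul, map_pow, aeval_C]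
      rfl

end CarlitzExponential

/-! ### The Galois group of a cyclotomic function field -/

section CyclotomicField

variable {F : Type*} [Field F] [Finite F]

/-- The `M`-torsion point `e_C(a π / M)` of the Carlitz module. -/
def torsionPoint (π : Omega F) (M a : F[X]) : Omega F := latticeExp π (polyMap a * π / polyMap M)

theorem torsionPoint_one (π : Omega F) (M : F[X]) :
    torsionPoint π M 1 = latticeExp π (π / polyMap M) := by simp [torsionPoint]

section Torsion

variable {π : Omega F} (hπ : IsCarlitzPeriod π) {M : F[X]} (hM : M.Monic)
include hπ

theorem aeval_torsionPoint (a b : F[X]) :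
    aeval (torsionPoint π M b) (carlitzPoly a) = torsionPoint π M (a * b) := by
  rw [torsionPoint, torsionPoint, ← latticeExp_polyMap_mul hπ, map_mul, mul_div_assoc,
    mul_div_assoc, mul_assoc]

theorem aeval_torsionPoint_one (a : F[X]) :
    aeval (torsionPoint π M 1) (carlitzPoly a) = torsionPoint π M a := by
  rw [aeval_torsionPoint hπ, mul_one]

theorem torsionPoint_add (a b : F[X]) :
    torsionPoint π M (a + b) = torsionPoint π M a + torsionPoint π M b := by
  rw [torsionPoint, map_add, add_mul, add_div, latticeExp_add hπ.1]; rfl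

include hM

theorem torsionPoint_eq_zero_iff (a : F[X]) : torsionPoint π M a = 0 ↔ M ∣ a := by
  have h0 : polyMap M ≠ 0 := (map_ne_zero_iff _ polyMap_injective).2 hM.ne_zero
  rw [torsionPoint, latticeExp_eq_zero_iff hπ.1]
  refine exists_congr fun b => ?_
  rw [div_eq_iff h0, mul_assoc, mul_comm _ π, mul_right_inj' hπ.1, ← map_mul,
    polyMap_injective.eq_iff, mul_comm b]

theorem torsionPoint_eq_iff (a b : F[X]) :
    torsionPoint π M a = torsionPoint π M b ↔ M ∣ a - b := by
  have h : torsionPoint π M a = torsionPoint π M (a - b) + torsionPoint π M b := by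
    rw [← torsionPoint_add hπ, sub_add_cancel]
  rw [h, add_eq_right, torsionPoint_eq_zero_iff hπ hM]

theorem torsionPoint_eq_iff_mk (a b : F[X]) : torsionPoint π M a = torsionPoint π M b ↔
    Ideal.Quotient.mk (Ideal.span {M}) a = Ideal.Quotient.mk (Ideal.span {M}) b := by
  rw [torsionPoint_eq_iff hπ hM, Ideal.Quotient.eq, Ideal.mem_span_singleton]

theorem aeval_torsionPoint_self (a : F[X]) :
    aeval (torsionPoint π M a) (carlitzPoly M) = 0 := by
  rw [aeval_torsionPoint hπ, torsionPoint_eq_zero_iff hπ hM]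
  exact dvd_mul_right _ _

/-- The `q ^ deg M` points `e_C(a π / M)`, `deg a < deg M`, are all the roots of `C_M`. -/
theorem exists_roots_carlitzPoly :
    ∃ R : Finset (Omega F), ((carlitzPoly M).map (algebraMap F[X] (Omega F))).roots = R.val ∧
      R.card = Nat.card F ^ M.natDegree ∧ ∀ y ∈ R, ∃ a, y = torsionPoint π M a := by
  classical
  obtain ⟨hm, hd⟩ := carlitzPoly_monic_natDegree hM
  set D := (finite_degree_lt (F := F) M.natDegree).toFinset with hD
  have hmem : ∀ a, a ∈ D ↔ a.degree < M.natDegree := fun a => by simp [hD]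
  have hDcard : D.card = Nat.card F ^ M.natDegree := by
    have h1 : Nat.card (degreeLT F M.natDegree) = Nat.card F ^ M.natDegree := by
      rw [Nat.card_congr (degreeLTEquiv F M.natDegree).toEquiv, Nat.card_fun, Nat.card_fin]
    rw [← h1, ← Set.ncard_eq_toFinset_card _ (finite_degree_lt M.natDegree),
      ← Nat.card_coe_set_eq]
    exact Nat.card_congr (Equiv.subtypeEquivRight fun a => mem_degreeLT.symm)
  have hinj : Set.InjOn (torsionPoint π M) D := fun a ha b hb h => by
    have h1 := (torsionPoint_eq_iff hπ hM a b).1 h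
    refine sub_eq_zero.1 (eq_zero_of_dvd_of_degree_lt h1 ?_)
    rw [degree_eq_natDegree hM.ne_zero]
    exact (degree_sub_le _ _).trans_lt (max_lt ((hmem a).1 ha) ((hmem b).1 hb))
  have hcard : (D.image (torsionPoint π M)).card = Nat.card F ^ M.natDegree := by
    rw [Finset.card_image_of_injOn hinj, hDcard]
  refine ⟨D.image (torsionPoint π M), ?_, hcard, fun y hy => ?_⟩
  · symm
    refine Multiset.eq_of_le_of_card_le ?_ ?_
    · refine (Multiset.le_iff_subset (Finset.nodup _)).2 fun y hy => ?_
      obtain ⟨a, -, rfl⟩ := Finset.mem_image.1 hy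
      rw [mem_roots (hm.map _).ne_zero, IsRoot.def, eval_map_algebraMap]
      exact aeval_torsionPoint_self hπ hM a
    · refine (card_roots' _).trans ?_
      rw [hm.natDegree_map, hd]
      exact hcard.ge
  · obtain ⟨a, -, rfl⟩ := Finset.mem_image.1 hy
    exact ⟨a, rfl⟩

theorem exists_eq_torsionPoint {y : Omega F} (hy : aeval y (carlitzPoly M) = 0) :
    ∃ a, y = torsionPoint π M a := by
  obtain ⟨R, hR, -, h⟩ := exists_roots_carlitzPoly hπ hM
  refine h y ?_
  rw [← Finset.mem_val, ← hR, mem_roots ((carlitzPoly_monic_natDegree hM).1.map _).ne_zero,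
    IsRoot.def, eval_map_algebraMap, hy]

end Torsion

section GaloisGroup

variable {π : Omega F} (hπ : IsCarlitzPeriod π) {M : F[X]} (hM : M.Monic)
  {K : IntermediateField (RatFunc F) (Omega F)} (hK : K = cyclotomicField π M)

theorem carlitzPoly_map_separable {M : F[X]} (hM : M ≠ 0) :
    ((carlitzPoly M).map (algebraMap F[X] (RatFunc F))).Separable := by
  have hMr : algebraMap F[X] (RatFunc F) M ≠ 0 :=
    (map_ne_zero_iff _ (RatFunc.algebraMap_injective F)).2 hM
  refine (separable_def _).2 ⟨0, C (algebraMap F[X] (RatFunc F) M)⁻¹, ?_⟩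
  rw [derivative_map, derivative_carlitzPoly, map_C, ← C_mul, inv_mul_cancel₀ hMr]
  simp

include hK in
theorem torsionPoint_one_mem : torsionPoint π M 1 ∈ K := by
  rw [hK, torsionPoint_one]
  exact IntermediateField.mem_adjoin_simple_self _ _

include hK hπ in
theorem torsionPoint_mem (a : F[X]) : torsionPoint π M a ∈ K := by
  have h := torsionPoint_one_mem hK
  rw [← aeval_torsionPoint_one hπ]
  have h' := (aeval (⟨_, h⟩ : K) (carlitzPoly a)).2
  rwa [← IntermediateField.aeval_coe] at h'

include hπ hM hK in
theorem isSplittingField_cyclotomicField :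
    ((carlitzPoly M).map (algebraMap F[X] (RatFunc F))).IsSplittingField (RatFunc F) K := by
  obtain ⟨hm, hd⟩ := carlitzPoly_monic_natDegree hM
  obtain ⟨R, hR, hcard, h⟩ := exists_roots_carlitzPoly hπ hM
  have hmap : ((carlitzPoly M).map (algebraMap F[X] (RatFunc F))).map
      (algebraMap (RatFunc F) (Omega F)) = (carlitzPoly M).map (algebraMap F[X] (Omega F)) := by
    rw [map_map, ← IsScalarTower.algebraMap_eq]
  have hs : (((carlitzPoly M).map (algebraMap F[X] (RatFunc F))).map
      (algebraMap (RatFunc F) (Omega F))).Splits := by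
    rw [hmap, splits_iff_card_roots, hR, hm.natDegree_map, hd]
    exact hcard
  have hroot : ∀ x ∈ ((carlitzPoly M).map (algebraMap F[X] (RatFunc F))).rootSet (Omega F),
      ∃ a, x = torsionPoint π M a := fun x hx => by
    refine exists_eq_torsionPoint hπ hM ?_
    rw [mem_rootSet, aeval_map_algebraMap] at hx
    exact hx.2
  refine IntermediateField.isSplittingField_iff.2 ⟨?_, ?_⟩
  · refine IntermediateField.splits_of_splits hs fun x hx => ?_
    obtain ⟨a, rfl⟩ := hroot x hx
    exact torsionPoint_mem hπ hK a
  · refine le_antisymm ?_ (IntermediateField.adjoin_le_iff.2 fun x hx => ?_)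
    · rw [hK, cyclotomicField, IntermediateField.adjoin_simple_le_iff, ← torsionPoint_one]
      refine IntermediateField.subset_adjoin _ _ ?_
      rw [mem_rootSet, aeval_map_algebraMap]
      exact ⟨(hm.map _).ne_zero, aeval_torsionPoint_self hπ hM 1⟩
    · obtain ⟨a, rfl⟩ := hroot x hx
      exact torsionPoint_mem hπ hK a

include hπ hM hK in
theorem isGalois_cyclotomicField : IsGalois (RatFunc F) K :=
  have := isSplittingField_cyclotomicField hπ hM hK
  IsGalois.of_separable_splitting_field (carlitzPoly_map_separable hM.ne_zero)

/-- The Galois action commutes with the Carlitz action. -/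
theorem algEquiv_aeval_carlitzPoly (σ : K ≃ₐ[RatFunc F] K) (a : F[X]) {x y : K}
    (h : (y : Omega F) = aeval (x : Omega F) (carlitzPoly a)) :
    (σ y : Omega F) = aeval (σ x : Omega F) (carlitzPoly a) := by
  rw [IntermediateField.aeval_coe, ← Subtype.ext_iff] at h
  rw [h, IntermediateField.aeval_coe]
  congr 1
  exact ((σ.toAlgHom.restrictScalars F[X]).comp (aeval x)).congr_arg rfl |>.trans
    (aeval_algHom_apply (σ.toAlgHom.restrictScalars F[X]) x (carlitzPoly a)).symm

include hπ hM hK in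
theorem exists_algEquiv_torsionPoint (σ : K ≃ₐ[RatFunc F] K) :
    ∃ a, (σ ⟨_, torsionPoint_one_mem hK⟩ : Omega F) = torsionPoint π M a := by
  refine exists_eq_torsionPoint hπ hM ?_
  rw [← algEquiv_aeval_carlitzPoly (K := K) (y := 0) σ M, map_zero, ZeroMemClass.coe_zero]
  rw [ZeroMemClass.coe_zero]
  exact (aeval_torsionPoint_self hπ hM 1).symm

include hπ in
theorem algEquiv_torsionPoint {σ : K ≃ₐ[RatFunc F] K} {a : F[X]}
    (h : (σ ⟨_, torsionPoint_one_mem hK⟩ : Omega F) = torsionPoint π M a) (b : F[X]) :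
    (σ ⟨_, torsionPoint_mem hπ hK b⟩ : Omega F) = torsionPoint π M (b * a) := by
  rw [algEquiv_aeval_carlitzPoly (x := ⟨_, torsionPoint_one_mem hK⟩) σ b
    (aeval_torsionPoint_one hπ b).symm, h, aeval_torsionPoint hπ]

include hK in
theorem algEquiv_ext_torsionPoint {σ τ : K ≃ₐ[RatFunc F] K}
    (h : (σ ⟨_, torsionPoint_one_mem hK⟩ : Omega F) = τ ⟨_, torsionPoint_one_mem hK⟩) :
    σ = τ := by
  have h' : σ.toAlgHom = τ.toAlgHom := by
    refine IntermediateField.algHom_ext_of_eq_adjoin (RatFunc F) (S := K)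
      (s := {torsionPoint π M 1}) (by rw [hK, torsionPoint_one]; rfl) fun x hx => ?_
    obtain rfl := Set.mem_singleton_iff.1 hx
    exact Subtype.ext h
  exact AlgEquiv.ext fun x => AlgHom.congr_fun h' x

include hπ hM hK in
/-- The torsion points `e_C(a π / M)` with `a` coprime to `M` are conjugate over `k`. -/
theorem exists_algEquiv_of_isCoprime {a : F[X]} (ha : a.Monic) (hcop : IsCoprime a M) :
    ∃ σ : K ≃ₐ[RatFunc F] K,
      (σ ⟨_, torsionPoint_one_mem hK⟩ : Omega F) = torsionPoint π M a := by
  have := isGalois_cyclotomicField hπ hM hK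
  have h0 := aeval_torsionPoint_self hπ hM 1
  have h1 := minpoly_carlitzPoly_of_coprime hM h0 ha hcop
  rw [aeval_torsionPoint_one hπ] at h1
  have h2 : minpoly (RatFunc F) (torsionPoint π M a) = minpoly (RatFunc F) (torsionPoint π M 1) := by
    rw [minpoly.isIntegrallyClosed_eq_field_fractions' (RatFunc F)
      (isIntegral_of_carlitzPoly hM h0), h1, minpoly.isIntegrallyClosed_eq_field_fractions'
      (RatFunc F) (isIntegral_of_carlitzPoly hM (aeval_torsionPoint_self hπ hM a))]
  have h3 : minpoly (RatFunc F) (⟨_, torsionPoint_mem hπ hK a⟩ : K) =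
      minpoly (RatFunc F) (⟨_, torsionPoint_one_mem hK⟩ : K) := by
    rw [IntermediateField.minpoly_eq, IntermediateField.minpoly_eq, h2]
  obtain ⟨σ, hσ⟩ := (Normal.minpoly_eq_iff_mem_orbit K).1 h3
  exact ⟨σ, congrArg Subtype.val hσ⟩

include hπ hM hK in
/-- The isomorphism `Gal(K/k) ≃ (𝔸 / M)^*`. -/
theorem exists_galois_mulEquiv_units :
    ∃ φ : (K ≃ₐ[RatFunc F] K) ≃* (F[X] ⧸ Ideal.span {M})ˣ,
      ∀ (σ : K ≃ₐ[RatFunc F] K) (a : F[X]), Ideal.Quotient.mk (Ideal.span {M}) a = φ σ →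
        (σ ⟨_, torsionPoint_one_mem hK⟩ : Omega F) = torsionPoint π M a := by
  choose α hα using exists_algEquiv_torsionPoint hπ hM hK
  let r := Ideal.Quotient.mk (Ideal.span {M})
  let φ₀ : (K ≃ₐ[RatFunc F] K) →* F[X] ⧸ Ideal.span {M} :=
    { toFun := fun σ => r (α σ)
      map_one' := by
        rw [← map_one r]
        refine (torsionPoint_eq_iff_mk hπ hM _ _).1 ?_
        rw [← hα, AlgEquiv.one_apply]
      map_mul' := fun σ τ => by
        rw [← map_mul]
        refine (torsionPoint_eq_iff_mk hπ hM _ _).1 ?_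
        rw [← hα, AlgEquiv.mul_apply, mul_comm, ← algEquiv_torsionPoint hπ hK (hα σ)]
        congr 2
        exact Subtype.ext (hα τ) }
  have hspec : ∀ σ (a : F[X]), r a = φ₀.toHomUnits σ →
      (σ ⟨_, torsionPoint_one_mem hK⟩ : Omega F) = torsionPoint π M a := fun σ a h => by
    rw [hα, torsionPoint_eq_iff_mk hπ hM]
    exact h.symm
  refine ⟨MulEquiv.ofBijective φ₀.toHomUnits ⟨fun σ τ h => ?_, fun u => ?_⟩, hspec⟩
  · refine algEquiv_ext_torsionPoint hK ?_
    rw [hspec σ (α σ) rfl, hspec τ (α σ) (by rw [← h]; rfl)]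
  · obtain ⟨b, hb⟩ := Ideal.Quotient.mk_surjective (I := Ideal.span {M}) (u : F[X] ⧸ Ideal.span {M})
    -- a monic representative of the class of `b`
    have hbM : (b %ₘ M).degree < (M * X).degree := by
      refine (degree_modByMonic_lt b hM).trans_le ?_
      rw [degree_mul_X]
      exact le_add_of_nonneg_right zero_le_one
    have hmonic : (M * X + b %ₘ M).Monic := (hM.mul monic_X).add_of_left hbM
    have hr : r (M * X + b %ₘ M) = u := by
      rw [← hb]
      refine Ideal.Quotient.eq.2 (Ideal.mem_span_singleton.2 ⟨X - b /ₘ M, ?_⟩)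
      linear_combination modByMonic_add_div b M
    have hcop : IsCoprime (M * X + b %ₘ M) M := by
      obtain ⟨c, hc⟩ := Ideal.Quotient.mk_surjective (I := Ideal.span {M})
        (↑u⁻¹ : F[X] ⧸ Ideal.span {M})
      have h1 : r ((M * X + b %ₘ M) * c) = r 1 := by
        rw [map_mul, hr, map_one]
        exact (congrArg (_ * ·) hc).trans u.mul_inv
      obtain ⟨d, hd⟩ := Ideal.mem_span_singleton.1 (Ideal.Quotient.eq.1 h1)
      exact ⟨c, -d, by linear_combination hd⟩
    obtain ⟨σ, hσ⟩ := exists_algEquiv_of_isCoprime hπ hM hK hmonic hcop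
    refine ⟨σ, Units.ext ?_⟩
    rw [← hr]
    exact (torsionPoint_eq_iff_mk hπ hM _ _).1 ((hα σ).symm.trans hσ)

end GaloisGroup

end CyclotomicField

/-! ### Direct products with a central Sylow subgroup -/

section SylowExtensions

variable {Γ G : Type*} [Group Γ] [Group G] {p : ℕ}

theorem mem_sylow_of_mem_center (S : Sylow p Γ) {g : Γ} (hc : g ∈ Subgroup.center Γ) {e : ℕ}
    (hg : g ^ p ^ e = 1) : g ∈ S := by
  have hn : (Subgroup.zpowers g).Normal := ⟨fun n hn x => by
    have h := Subgroup.mem_center_iff.1 ((Subgroup.zpowers_le.2 hc) hn) x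
    rwa [h, mul_inv_cancel_right]⟩
  have hp : IsPGroup p (Subgroup.zpowers g) := by
    rintro ⟨_, k, rfl⟩
    refine ⟨e, Subtype.ext ?_⟩
    change (g ^ k) ^ p ^ e = 1
    rw [← zpow_natCast, zpow_comm, zpow_natCast, hg, one_zpow]
  have h := S.is_maximal' (S.isPGroup'.to_sup_of_normal_right hp) le_sup_left
  change g ∈ (S : Subgroup Γ)
  rw [← h]
  exact Subgroup.mem_sup_right (Subgroup.mem_zpowers g)

variable (hG : ∀ σ τ : G, σ * τ = τ * σ) {ρ : Γ →* G}
  (hcenter : ∀ (g : Γ) (e : ℕ), g ^ p ^ e = 1 → g ∈ Subgroup.center Γ)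
  (hlift : ∀ (σ : G) (e : ℕ), σ ^ p ^ e = 1 → ∃ τ, τ ^ p ^ e = 1 ∧ ρ τ = σ)
  (hker : ∀ (g : Γ) (e : ℕ), g ^ p ^ e = 1 → ρ g = 1 → g = 1)

include hG in
theorem mem_sylow_of_comm (T : Sylow p G) {σ : G} {e : ℕ} (h : σ ^ p ^ e = 1) : σ ∈ T :=
  mem_sylow_of_mem_center T (Subgroup.mem_center_iff.2 fun τ => hG τ σ) h

include hlift in
theorem nonempty_quotient_mulEquiv (T : Sylow p G) :
    ∃ _ : (ρ.ker.subgroupOf (Subgroup.comap ρ T)).Normal,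
      Nonempty ((Subgroup.comap ρ T ⧸ ρ.ker.subgroupOf (Subgroup.comap ρ T)) ≃* T) := by
  let f : Subgroup.comap ρ (T : Subgroup G) →* T :=
    (ρ.comp (Subgroup.comap ρ (T : Subgroup G)).subtype).codRestrict (T : Subgroup G) fun x => x.2
  have hf : Function.Surjective f := fun σ => by
    obtain ⟨e, he⟩ := T.isPGroup' σ
    obtain ⟨τ, -, hτ⟩ := hlift σ e (congrArg Subtype.val he)
    exact ⟨⟨τ, by rw [Subgroup.mem_comap, hτ]; exact σ.2⟩, Subtype.ext hτ⟩
  have hk : ρ.ker.subgroupOf (Subgroup.comap ρ T) = f.ker := by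
    ext x
    rw [Subgroup.mem_subgroupOf, MonoidHom.mem_ker, MonoidHom.mem_ker, Subtype.ext_iff]
    rfl
  rw [hk]
  exact ⟨inferInstance, ⟨QuotientGroup.quotientKerEquivOfSurjective f hf⟩⟩

include hG hcenter hlift hker in
/-- If the `p`-elements of `Γ` are central, lift those of `G`, and meet the kernel trivially, then the
Sylow subgroups of `Γ` and `G` agree. -/
theorem nonempty_sylow_mulEquiv (S : Sylow p Γ) (T : Sylow p G) : Nonempty (S ≃* T) := by
  have hST : ∀ x : S, ρ x ∈ (T : Subgroup G) := fun x => by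
    obtain ⟨e, he⟩ := S.isPGroup' x
    refine mem_sylow_of_comm hG T (e := e) ?_
    rw [← map_pow]
    exact (congrArg ρ (congrArg Subtype.val he)).trans ρ.map_one
  let f : S →* T := (ρ.comp (S : Subgroup Γ).subtype).codRestrict (T : Subgroup G) hST
  refine ⟨MulEquiv.ofBijective f ⟨(injective_iff_map_eq_one f).2 fun x hx => ?_, fun σ => ?_⟩⟩
  · obtain ⟨e, he⟩ := S.isPGroup' x
    exact Subtype.ext (hker x e (congrArg Subtype.val he) (congrArg Subtype.val hx))
  · obtain ⟨e, he⟩ := T.isPGroup' σ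
    obtain ⟨τ, hτ, hτσ⟩ := hlift σ e (congrArg Subtype.val he)
    exact ⟨⟨τ, mem_sylow_of_mem_center S (hcenter τ e hτ) hτ⟩, Subtype.ext hτσ⟩

include hcenter hlift hker in
/-- If `G` is generated by its `p`-elements and a subgroup `H` without `p`-torsion, then `Γ` is the
direct product of its Sylow subgroup and the preimage of `H`. -/
theorem exists_sylow_prod_mulEquiv (S : Sylow p Γ) (H : Subgroup G)
    (hH : ∀ (σ : G) (e : ℕ), σ ∈ H → σ ^ p ^ e = 1 → σ = 1)
    (hgen : ∀ σ : G, ∃ τ ∈ H, ∃ e, (σ * τ⁻¹) ^ p ^ e = 1) :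
    ∃ f : (S × Subgroup.comap ρ H) ≃* Γ, ∀ x, f x = (x.1 : Γ) * (x.2 : Γ) := by
  have hS : ∀ x : S, ∃ e, (x : Γ) ^ p ^ e = 1 := fun x => by
    obtain ⟨e, he⟩ := S.isPGroup' x
    exact ⟨e, congrArg Subtype.val he⟩
  have hSc : ∀ (x : S) (g : Γ), g * x = x * g := fun x g => by
    obtain ⟨e, he⟩ := hS x
    exact Subgroup.mem_center_iff.1 (hcenter x e he) g
  let f : (S × Subgroup.comap ρ H) →* Γ :=
    { toFun := fun x => (x.1 : Γ) * (x.2 : Γ)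
      map_one' := mul_one _
      map_mul' := fun x y => by
        change ((x.1 : Γ) * y.1) * ((x.2 : Γ) * y.2) = (x.1 : Γ) * x.2 * (y.1 * y.2)
        rw [mul_assoc, mul_assoc, ← mul_assoc (y.1 : Γ), ← mul_assoc (x.2 : Γ), hSc] }
  refine ⟨MulEquiv.ofBijective f ⟨(injective_iff_map_eq_one f).2 fun x hx => ?_, fun g => ?_⟩,
    fun x => rfl⟩
  · obtain ⟨⟨x, hxS⟩, ⟨y, hy⟩⟩ := x
    have hxy : x * y = 1 := hx
    obtain ⟨e, he⟩ := hS ⟨x, hxS⟩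
    have hx' : x = y⁻¹ := eq_inv_of_mul_eq_one_left hxy
    have h1 : ρ x ∈ H := by rw [hx', map_inv]; exact H.inv_mem hy
    have h2 : x = 1 := hker x e he (hH _ e h1 (by
      rw [← map_pow]; exact (congrArg ρ he).trans ρ.map_one))
    refine Prod.ext (Subtype.ext h2) (Subtype.ext ?_)
    rw [h2, one_mul] at hxy
    exact hxy
  · obtain ⟨τ, hτ, e, he⟩ := hgen (ρ g)
    obtain ⟨t, ht, htρ⟩ := hlift _ e he
    refine ⟨(⟨t, mem_sylow_of_mem_center S (hcenter t e ht) ht⟩, ⟨t⁻¹ * g, ?_⟩),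
      mul_inv_cancel_left t g⟩
    rw [Subgroup.mem_comap, map_mul, map_inv, htρ, mul_inv_rev, inv_inv, inv_mul_cancel_right]
    exact hτ

end SylowExtensions

/-! ### Roots of unity and liftings of automorphisms -/

section Coprimality

theorem mem_of_pow_mem_of_coprime {G : Type*} [Group G] (H : Subgroup G) {g : G} {m n : ℕ}
    (hmn : m.Coprime n) (hm : g ^ m ∈ H) (hn : g ^ n ∈ H) : g ∈ H := by
  have h := Nat.gcd_eq_gcd_ab m n
  rw [hmn.gcd_eq_one, Nat.cast_one] at h
  rw [← zpow_one g, h, zpow_add, zpow_mul, zpow_mul, zpow_natCast, zpow_natCast]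
  exact H.mul_mem (H.zpow_mem hm _) (H.zpow_mem hn _)

theorem dvd_natCard (F : Type*) [Field F] [Finite F] (p : ℕ) [CharP F p] :
    p ∣ Nat.card F := by
  have := Fintype.ofFinite F
  obtain ⟨n, -, h⟩ := FiniteField.card F p
  rw [Nat.card_eq_fintype_card, h]
  exact dvd_pow_self p n.ne_zero

theorem coprime_natCard_pow_sub_one (F : Type*) [Field F] [Finite F] (p : ℕ) [Fact p.Prime]
    [CharP F p] {d : ℕ} (hd : d ≠ 0) : p.Coprime (Nat.card F ^ d - 1) := by
  rw [(Fact.out : p.Prime).coprime_iff_not_dvd]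
  intro h
  have h1 : p ∣ Nat.card F ^ d := dvd_pow (dvd_natCard F p) hd
  have h2 := Nat.dvd_sub h1 h
  rw [Nat.sub_sub_self (Nat.one_le_pow _ _ Nat.card_pos)] at h2
  exact (Fact.out : p.Prime).one_lt.ne' (Nat.dvd_one.1 h2)

theorem coprime_two_mul_natCard_sub_one (F : Type*) [Field F] [Finite F] (p : ℕ) [Fact p.Prime]
    [CharP F p] (hp : p ≠ 2) : p.Coprime (2 * (Nat.card F - 1)) := by
  refine Nat.Coprime.mul_right ((Nat.coprime_primes Fact.out Nat.prime_two).2 hp) ?_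
  simpa using coprime_natCard_pow_sub_one F p one_ne_zero

end Coprimality

section RootsOfUnity

variable {F : Type*} [Field F] [Finite F]

theorem exists_eq_of_pow_natCard_eq {N : Type*} [Field N] (f : F →+* N) {y : N}
    (hy : y ^ Nat.card F = y) : ∃ c, y = f c := by
  have := Fintype.ofFinite F
  have hq := Fintype.one_lt_card (α := F)
  have hsplit : (X ^ Fintype.card F - X : F[X]).Splits := by
    rw [splits_iff_card_roots, FiniteField.roots_X_pow_card_sub_X,
      FiniteField.X_pow_card_sub_X_natDegree_eq F hq]
    rfl
  have h1 := Polynomial.Splits.roots_map hsplit f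
  have h2 : y ∈ ((X ^ Fintype.card F - X : F[X]).map f).roots := by
    rw [mem_roots ((Polynomial.map_ne_zero_iff f.injective).2
      (FiniteField.X_pow_card_sub_X_ne_zero F hq))]
    simp [← Nat.card_eq_fintype_card, hy]
  rw [h1] at h2
  obtain ⟨c, -, hc⟩ := Multiset.mem_map.1 h2
  exact ⟨c, hc.symm⟩

/-- The square of a `2(q - 1)`-st root of unity lies in `F^*`. -/
theorem exists_sq_eq_of_pow_eq_one {N : Type*} [Field N] (f : F →+* N) {y : N}
    (hy : y ^ (2 * (Nat.card F - 1)) = 1) : ∃ c, c ≠ 0 ∧ y ^ 2 = f c := by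
  have h0 : (y ^ 2) ^ Nat.card F = y ^ 2 := by
    have hq : Nat.card F = (Nat.card F - 1) + 1 := (Nat.sub_add_cancel Nat.card_pos).symm
    rw [hq, pow_succ, ← pow_mul, hy, one_mul]
  obtain ⟨c, hc⟩ := exists_eq_of_pow_natCard_eq f h0
  refine ⟨c, fun h => ?_, hc⟩
  rw [h, map_zero] at hc
  rw [pow_mul, hc, zero_pow (Nat.sub_pos_of_lt Finite.one_lt_card).ne'] at hy
  exact zero_ne_one hy

/-- If `τ` fixes `x ^ (2(q - 1))`, then `ξ = τ x / x` has its square in `F`, so `τ ξ = ± ξ` and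
`τ (τ x) = ± ξ ^ 2 x`, where `± ξ ^ 2 ∈ F^*`. -/
theorem algEquiv_pow_apply_eq {N : Type*} [Field N] [Algebra (RatFunc F) N]
    (τ : N ≃ₐ[RatFunc F] N) {x : N}
    (hx : τ (x ^ (2 * (Nat.card F - 1))) = x ^ (2 * (Nat.card F - 1))) :
    (τ ^ (2 * (Nat.card F - 1))) x = x := by
  by_cases hx0 : x = 0
  · rw [hx0, map_zero]
  set f : F →+* N := (algebraMap (RatFunc F) N).comp (algebraMap F (RatFunc F)) with hf
  have hτf : ∀ c, τ (f c) = f c := fun c => τ.commutes _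
  obtain ⟨c, hc0, hc⟩ : ∃ c, c ≠ 0 ∧ (τ x / x) ^ 2 = f c := by
    refine exists_sq_eq_of_pow_eq_one f ?_
    rw [div_pow, ← map_pow, hx, div_self (pow_ne_zero _ hx0)]
  have h1 : τ x = τ x / x * x := (div_mul_cancel₀ _ hx0).symm
  have h2 : ∃ d : F, d ≠ 0 ∧ τ (τ x) = f d * x := by
    have h3 : τ (τ x / x) ^ 2 = (τ x / x) ^ 2 := by rw [← map_pow, hc, hτf]
    have h4 : τ (τ x) = τ (τ x / x) * (τ x / x * x) := by
      conv_lhs => rw [h1, map_mul]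
      rw [← h1]
    rcases sq_eq_sq_iff_eq_or_eq_neg.1 h3 with h | h
    · exact ⟨c, hc0, by rw [h4, h, ← hc]; ring⟩
    · exact ⟨-c, neg_ne_zero.2 hc0, by rw [h4, h, map_neg, ← hc]; ring⟩
  obtain ⟨d, hd0, hd⟩ := h2
  have h5 : ∀ n : ℕ, ((τ ^ 2) ^ n) x = f d ^ n * x := fun n => by
    induction n with
    | zero => simp
    | succ n ih =>
      rw [pow_succ', AlgEquiv.mul_apply, ih, map_mul, ← map_pow, sq, AlgEquiv.mul_apply,
        AlgEquiv.mul_apply, hτf, hτf, hd, pow_succ, map_pow]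
      ring
  have := Fintype.ofFinite F
  rw [pow_mul, h5, ← map_pow, Nat.card_eq_fintype_card, FiniteField.pow_card_sub_one_eq_one d hd0,
    map_one, one_mul]

theorem algEquiv_apply_eq_of_pow_eq_one {p : ℕ} [Fact p.Prime] [CharP F p] (hp : p ≠ 2)
    {N : Type*} [Field N] [Algebra (RatFunc F) N] {τ : N ≃ₐ[RatFunc F] N} {e : ℕ}
    (hτ : τ ^ p ^ e = 1) {x : N}
    (hx : τ (x ^ (2 * (Nat.card F - 1))) = x ^ (2 * (Nat.card F - 1))) : τ x = x :=
  mem_of_pow_mem_of_coprime (MulAction.stabilizer (N ≃ₐ[RatFunc F] N) x)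
    ((coprime_two_mul_natCard_sub_one F p hp).pow_left e)
    (by rw [hτ]; exact one_mem _) (algEquiv_pow_apply_eq τ hx)

end RootsOfUnity

section Liftings

variable {k E : Type*} [Field k] [Field E] [Algebra k E] {K L : IntermediateField k E}

/-- Restriction to a normal subfield, as a homomorphism that characterizes `IsLift`. -/
theorem exists_restrictHom [Normal k K] (h : K ≤ L) :
    ∃ ρ : (L ≃ₐ[k] L) →* (K ≃ₐ[k] K), ∀ τ σ, IsLift h τ σ ↔ ρ τ = σ := by
  let : Algebra K L := (IntermediateField.inclusion h).toRingHom.toAlgebra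
  have : IsScalarTower k K L := IsScalarTower.of_algebraMap_eq fun x =>
    ((IntermediateField.inclusion h).commutes x).symm
  have hρ : ∀ (τ : L ≃ₐ[k] L) (x : K), IntermediateField.inclusion h
      (AlgEquiv.restrictNormalHom K τ x) = τ (IntermediateField.inclusion h x) := fun τ x =>
    AlgEquiv.restrictNormal_commutes τ K x
  refine ⟨AlgEquiv.restrictNormalHom K, fun τ σ => ⟨fun hτ => AlgEquiv.ext fun x => ?_, ?_⟩⟩
  · exact (IntermediateField.inclusion h).injective ((hρ τ x).trans (hτ x))
  · rintro rfl x
    exact (hρ τ x).symm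

theorem algHom_ext_quasiField {θ : E} (h : K ≤ L)
    (hL : L = (IntermediateField.adjoin K {θ}).restrictScalars k) {N : Type*} [Field N]
    [Algebra k N] {f g : L →ₐ[k] N} (hK : ∀ x : K, f (IntermediateField.inclusion h x) =
      g (IntermediateField.inclusion h x)) (hθ : ∀ t : L, (t : E) = θ → f t = g t) : f = g := by
  rw [IntermediateField.restrictScalars_adjoin] at hL
  refine IntermediateField.algHom_ext_of_eq_adjoin k hL fun x hx => ?_
  rcases hx with hx | hx
  · exact hK ⟨x, hx⟩
  · exact hθ _ hx

end Liftings

section LiftingsOfPElements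

variable {F : Type*} [Field F] {p : ℕ} [Fact p.Prime] [CharP F p] (hp : p ≠ 2)
  {E : Type*} [Field E] [Algebra (RatFunc F) E] {K L : IntermediateField (RatFunc F) E}
  (h : K ≤ L) {θ : E} (hL : L = (IntermediateField.adjoin K {θ}).restrictScalars (RatFunc F))

include hL in
theorem mem_of_eq_quasiField : θ ∈ L := by
  rw [hL]
  exact IntermediateField.mem_adjoin_simple_self K θ

variable [Finite F] {w : K} (hw : (w : E) = θ ^ (2 * (Nat.card F - 1)))

include hL hw in
theorem isAlgebraic_quasiField [Algebra.IsAlgebraic (RatFunc F) K] :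
    Algebra.IsAlgebraic (RatFunc F) L := by
  have h1 : ∀ x ∈ (K : Set E) ∪ {θ}, IsIntegral (RatFunc F) x := by
    rintro x (hx | rfl)
    · exact (IntermediateField.isIntegral_iff (x := (⟨x, hx⟩ : K))).1
        (Algebra.IsAlgebraic.isAlgebraic _).isIntegral
    · refine IsIntegral.of_pow (n := 2 * (Nat.card F - 1)) ?_ ?_
      · have := Finite.one_lt_card (α := F)
        omega
      · rw [← hw]
        exact IntermediateField.isIntegral_iff.1 (Algebra.IsAlgebraic.isAlgebraic w).isIntegral
  rw [IntermediateField.restrictScalars_adjoin] at hL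
  rw [hL]
  exact IntermediateField.isAlgebraic_adjoin h1

include hp hL hw in
/-- A lift of `σ` to an automorphism of the algebraic closure of `K(θ)` multiplies `θ` by a root of
unity, and so a power of it that is prime to `p` fixes `θ`. -/
theorem exists_lift_of_pow_eq_one [Normal (RatFunc F) K] {σ : K ≃ₐ[RatFunc F] K} {e : ℕ}
    (hσ : σ ^ p ^ e = 1) (hσw : σ w = w) :
    ∃ τ : L ≃ₐ[RatFunc F] L, τ ^ p ^ e = 1 ∧ IsLift h τ σ := by
  have := isAlgebraic_quasiField hL hw
  let : Algebra K L := (IntermediateField.inclusion h).toRingHom.toAlgebra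
  have : IsScalarTower (RatFunc F) K L := IsScalarTower.of_algebraMap_eq fun x =>
    ((IntermediateField.inclusion h).commutes x).symm
  let N := AlgebraicClosure L
  have : Algebra.IsAlgebraic (RatFunc F) N := Algebra.IsAlgebraic.trans (RatFunc F) L N
  have : IsAlgClosure (RatFunc F) N := ⟨inferInstance, inferInstance⟩
  have : Normal (RatFunc F) N := IsAlgClosure.normal _ _
  set m := 2 * (Nat.card F - 1) with hm
  let t : L := ⟨θ, mem_of_eq_quasiField hL⟩
  let j : L →ₐ[RatFunc F] N := IsScalarTower.toAlgHom (RatFunc F) L N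
  let σ' : N ≃ₐ[RatFunc F] N := σ.liftNormal N
  have hσ' : ∀ x : K, σ' (j (IntermediateField.inclusion h x)) =
      j (IntermediateField.inclusion h (σ x)) := fun x => σ.liftNormal_commutes N x
  have hσn : ∀ (n : ℕ) (x : K), (σ' ^ n) (j (IntermediateField.inclusion h x)) =
      j (IntermediateField.inclusion h ((σ ^ n) x)) := fun n => by
    induction n with
    | zero => intro x; rfl
    | succ n ih =>
      intro x
      rw [pow_succ, pow_succ, AlgEquiv.mul_apply, AlgEquiv.mul_apply, hσ', ih]
  have htw : j t ^ m = j (IntermediateField.inclusion h w) := by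
    rw [← map_pow]
    exact congrArg j (Subtype.ext hw.symm)
  have hfix : (σ' ^ m) (j t) = j t := algEquiv_pow_apply_eq σ' (by rw [← hm, htw, hσ', hσw])
  -- `m` is prime to the order of `σ`, so some power of `σ' ^ m` still restricts to `σ`
  obtain ⟨n, hn⟩ : ∃ n, σ ^ (m * n) = σ := by
    have hcop : m.Coprime (orderOf σ) :=
      ((coprime_two_mul_natCard_sub_one F p hp).pow_left e).symm.coprime_dvd_right
        (orderOf_dvd_of_pow_eq_one hσ)
    obtain ⟨n, hn⟩ := exists_pow_eq_self_of_coprime hcop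
    exact ⟨n, by rw [pow_mul, hn]⟩
  set ρ := σ' ^ (m * n) with hρ
  have hρt : ρ (j t) = j t := by
    have h1 : σ' ^ m ∈ MulAction.stabilizer (N ≃ₐ[RatFunc F] N) (j t) := hfix
    have h2 := pow_mem h1 n
    rwa [← pow_mul] at h2
  have hρK : ∀ x : K, ρ (j (IntermediateField.inclusion h x)) =
      j (IntermediateField.inclusion h (σ x)) := fun x => by rw [hρ, hσn, hn]
  -- `ρ` maps `K` and `θ`, hence `K(θ)`, into `K(θ)`
  have hrange : ∀ x : L, ρ (j x) ∈ j.range := by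
    have h1 : L ≤ (IntermediateField.comap (ρ.toAlgHom.comp j) j.fieldRange).map L.val := by
      conv_lhs => rw [hL, IntermediateField.restrictScalars_adjoin]
      refine IntermediateField.adjoin_le_iff.2 ?_
      rintro x (hx | hx)
      · exact ⟨IntermediateField.inclusion h ⟨x, hx⟩, ⟨_, (hρK ⟨x, hx⟩).symm⟩, rfl⟩
      · exact ⟨t, ⟨t, hρt.symm⟩, (Set.mem_singleton_iff.1 hx).symm⟩
    intro x
    obtain ⟨y, ⟨z, hz⟩, hy⟩ := h1 x.2
    have hyx : y = x := Subtype.ext hy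
    exact ⟨z, by rw [← hyx]; exact hz⟩
  let τ₀ : L →ₐ[RatFunc F] L := (AlgEquiv.ofInjectiveField j).symm.toAlgHom.comp
    ((ρ.toAlgHom.comp j).codRestrict j.range hrange)
  have hτ₀ : ∀ x, j (τ₀ x) = ρ (j x) := fun x => congrArg Subtype.val
    ((AlgEquiv.ofInjectiveField j).apply_symm_apply ⟨ρ (j x), hrange x⟩)
  let τ : L ≃ₐ[RatFunc F] L := AlgEquiv.ofBijective τ₀ (Algebra.IsAlgebraic.algHom_bijective τ₀)
  have hτ : ∀ x, j (τ x) = ρ (j x) := hτ₀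
  have hlift : IsLift h τ σ := fun x => j.injective ((hτ _).trans (hρK x))
  have hliftn : ∀ n : ℕ, IsLift h (τ ^ n) (σ ^ n) := fun n => by
    induction n with
    | zero => exact fun x => rfl
    | succ n ih =>
      intro x
      rw [pow_succ, pow_succ, AlgEquiv.mul_apply, AlgEquiv.mul_apply, hlift, ih]
  have hτt : τ t = t := j.injective ((hτ t).trans hρt)
  refine ⟨τ, ?_, hlift⟩
  have h1 : (τ ^ p ^ e).toAlgHom = (1 : L ≃ₐ[RatFunc F] L).toAlgHom := by
    refine algHom_ext_quasiField h hL (fun x => ?_) fun s hs => ?_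
    · exact (hliftn (p ^ e) x).trans (by rw [hσ]; rfl)
    · obtain rfl : s = t := Subtype.ext hs
      exact pow_mem (show τ ∈ MulAction.stabilizer (L ≃ₐ[RatFunc F] L) t from hτt) (p ^ e)
  exact AlgEquiv.ext fun x => AlgHom.congr_fun h1 x

end LiftingsOfPElements

/-! ### Central `p`-elements, the element `u`, and congruences modulo `M` -/

section CentralPElements

variable {F : Type*} [Field F] [Finite F] {p : ℕ} [Fact p.Prime] [CharP F p] (hp : p ≠ 2)
  {E : Type*} [Field E] [Algebra (RatFunc F) E] {K L : IntermediateField (RatFunc F) E}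
  {h : K ≤ L} {θ : E} (hL : L = (IntermediateField.adjoin K {θ}).restrictScalars (RatFunc F))
  {w : K} (hw : (w : E) = θ ^ (2 * (Nat.card F - 1)))
  {ρ : (L ≃ₐ[RatFunc F] L) →* (K ≃ₐ[RatFunc F] K)} (hρ : ∀ τ σ, IsLift h τ σ ↔ ρ τ = σ)
  (hwfix : ∀ (σ : K ≃ₐ[RatFunc F] K) (e : ℕ), σ ^ p ^ e = 1 → σ w = w)

include hp hw hρ hwfix in
/-- The `p`-elements of `Gal(K(θ)/k)` fix all the conjugates of `θ`, since they fix those of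
`w = θ ^ (2(q - 1))`. -/
theorem apply_conj_eq_of_pow_eq_one (hG : ∀ σ τ : K ≃ₐ[RatFunc F] K, σ * τ = τ * σ)
    {τ : L ≃ₐ[RatFunc F] L} {e : ℕ} (hτ : τ ^ p ^ e = 1) (g : L ≃ₐ[RatFunc F] L) {t : L}
    (ht : (t : E) = θ) : τ (g t) = g t := by
  refine algEquiv_apply_eq_of_pow_eq_one hp hτ ?_
  have htw : t ^ (2 * (Nat.card F - 1)) = IntermediateField.inclusion h w :=
    Subtype.ext (by rw [SubmonoidClass.coe_pow, ht, ← hw]; rfl)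
  have h1 : ρ τ w = w := hwfix _ e (by rw [← map_pow, hτ, map_one])
  rw [← map_pow, htw, (hρ g _).2 rfl, (hρ τ _).2 rfl, ← AlgEquiv.mul_apply, hG,
    AlgEquiv.mul_apply, h1]

include hp hL hw hρ hwfix in
theorem mem_center_of_pow_eq_one (hG : ∀ σ τ : K ≃ₐ[RatFunc F] K, σ * τ = τ * σ)
    {τ : L ≃ₐ[RatFunc F] L} {e : ℕ} (hτ : τ ^ p ^ e = 1) :
    τ ∈ Subgroup.center (L ≃ₐ[RatFunc F] L) := by
  refine Subgroup.mem_center_iff.2 fun g => ?_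
  have h1 : (g * τ).toAlgHom = (τ * g).toAlgHom := by
    refine algHom_ext_quasiField h hL (fun x => ?_) fun s hs => ?_
    · change (g * τ) _ = (τ * g) _
      rw [(hρ (g * τ) _).2 rfl, (hρ (τ * g) _).2 rfl, map_mul, map_mul, hG]
    · change g (τ s) = τ (g s)
      rw [apply_conj_eq_of_pow_eq_one hp hw hρ hwfix hG hτ g hs]
      exact congrArg g (apply_conj_eq_of_pow_eq_one hp hw hρ hwfix hG hτ 1 hs)
  exact AlgEquiv.ext fun x => AlgHom.congr_fun h1 x

include hp hL hw hρ hwfix in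
theorem eq_one_of_pow_eq_one_of_restrict (hG : ∀ σ τ : K ≃ₐ[RatFunc F] K, σ * τ = τ * σ)
    {τ : L ≃ₐ[RatFunc F] L} {e : ℕ} (hτ : τ ^ p ^ e = 1) (hτ1 : ρ τ = 1) : τ = 1 := by
  have h1 : τ.toAlgHom = (1 : L ≃ₐ[RatFunc F] L).toAlgHom := by
    refine algHom_ext_quasiField h hL (fun x => ?_) fun s hs => ?_
    · change τ _ = _
      rw [(hρ τ _).2 rfl, hτ1]
      rfl
    · exact apply_conj_eq_of_pow_eq_one hp hw hρ hwfix hG hτ 1 hs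
  exact AlgEquiv.ext fun x => AlgHom.congr_fun h1 x

end CentralPElements

section SineElement

variable {F : Type*} [Field F] [Finite F]

/-- The chosen root `ι` of `-1` need not lie in the cyclotomic field, but `ι ^ 2 ∈ F`. -/
theorem mem_of_pow_eq_neg_one {ι : Omega F} (hι : ι ^ (Nat.card F - 1) = -1)
    (E : IntermediateField (RatFunc F) (Omega F)) : ι ^ 2 ∈ E := by
  obtain ⟨c, -, hc⟩ := exists_sq_eq_of_pow_eq_one (algebraMap F (Omega F)) (y := ι)
    (by rw [mul_comm, pow_mul, hι]; norm_num)
  rw [hc, IsScalarTower.algebraMap_apply F (RatFunc F) (Omega F)]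
  exact E.algebraMap_mem _

omit [Finite F] in
/-- The arguments of the sine at the symbols `[f / D]` again have denominator `D`. -/
theorem exists_fracPart_div_sgn (f : F[X]) {D : F[X]} (hD : D ≠ 0) (s : F) :
    ∃ g : F[X], fracPart (algebraMap F[X] (RatFunc F) f / algebraMap F[X] (RatFunc F) D) /
      RatFunc.C s = algebraMap F[X] (RatFunc F) g / algebraMap F[X] (RatFunc F) D := by
  set x := algebraMap F[X] (RatFunc F) f / algebraMap F[X] (RatFunc F) D with hx
  obtain ⟨d, hd⟩ : x.denom ∣ D := RatFunc.denom_div_dvd f D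
  have hinj : ∀ a : F[X], a ≠ 0 → algebraMap F[X] (RatFunc F) a ≠ 0 := fun a ha =>
    (map_ne_zero_iff _ (RatFunc.algebraMap_injective F)).2 ha
  have hd0 : d ≠ 0 := fun h => hD (by rw [hd, h, mul_zero])
  refine ⟨C s⁻¹ * (x.num % x.denom) * d, ?_⟩
  rw [fracPart]
  conv_rhs => rw [hd]
  rw [map_mul, map_mul, map_mul, mul_div_mul_right _ _ (hinj d hd0), RatFunc.algebraMap_C,
    map_inv₀, div_div, mul_comm _ (RatFunc.C s), ← div_div, div_eq_mul_inv _ (RatFunc.C s)]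
  ring

theorem exists_of_mem_support_aPQ {γ : Fˣ} {P Q : F[X]} {c : RatFunc F ⧸ polySubgroup F}
    (hc : c ∈ (aPQ γ P Q).support) : ∃ f : F[X], c = QuotientAddGroup.mk
      (algebraMap F[X] (RatFunc F) f / algebraMap F[X] (RatFunc F) (P * Q)) := by
  let V := Finsupp.supported ℤ ℤ {c : RatFunc F ⧸ polySubgroup F | ∃ f : F[X],
    c = QuotientAddGroup.mk
      (algebraMap F[X] (RatFunc F) f / algebraMap F[X] (RatFunc F) (P * Q))}
  have hs : ∀ f, symb f (P * Q) ∈ V := fun f =>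
    Finsupp.single_mem_supported ℤ _ ⟨f, rfl⟩
  have h : aPQ γ P Q ∈ V := Submodule.sum_mem _ fun A _ => Submodule.sum_mem _ fun B _ =>
    Submodule.sum_mem _ fun s _ => V.smul_mem _ (V.sub_mem (hs _) (hs _))
  exact (Finsupp.mem_supported ℤ _).1 h hc

/-- The square roots in `u` square to elements of `𝔸`, and each factor of the sine squares to
`ι ^ 2 ∈ F` times the square of a `P Q`-torsion point. -/
theorem sq_uPQ_mem {π ι : Omega F} (hι : ι ^ (Nat.card F - 1) = -1) {sqrt : F[X] → Omega F}
    (hsqrt : ∀ f : F[X], sqrt f ^ 2 = polyMap f) (γ : Fˣ) {P Q : F[X]} (hPQ : P * Q ≠ 0)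
    (E : IntermediateField (RatFunc F) (Omega F))
    (hE : ∀ g : F[X], latticeExp π (π * algebraMap (RatFunc F) (Omega F)
      (algebraMap F[X] (RatFunc F) g / algebraMap F[X] (RatFunc F) (P * Q))) ∈ E) :
    uPQ π ι sqrt γ P Q ^ 2 ∈ E := by
  have hclass : ∀ c ∈ (aPQ γ P Q).support, sinClass π ι c ^ 2 ∈ E := fun c hc => by
    obtain ⟨f, rfl⟩ := exists_of_mem_support_aPQ hc
    rw [sinClass]
    split_ifs
    · rw [one_pow]; exact one_mem E
    · rw [mul_pow]
      refine mul_mem (mem_of_pow_eq_neg_one hι E) (pow_mem ?_ 2)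
      obtain ⟨g, hg⟩ := exists_fracPart_div_sgn f hPQ
        (sgn (fracRep (QuotientAddGroup.mk (s := polySubgroup F)
          (algebraMap F[X] (RatFunc F) f / algebraMap F[X] (RatFunc F) (P * Q)))))
      have hg' := hE g
      rw [← hg] at hg'
      exact hg'
  have hsin : sinHom π ι (aPQ γ P Q) ^ 2 ∈ E := by
    rw [sinHom, Finsupp.prod, ← Finset.prod_pow]
    refine prod_mem fun c hc => ?_
    rw [← zpow_natCast, zpow_comm, zpow_natCast]
    exact zpow_mem (hclass c hc) _
  have hs : ∀ f, sqrt f ^ 2 ∈ E := fun f => by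
    rw [hsqrt]
    exact E.algebraMap_mem _
  rw [uPQ]
  split_ifs
  · exact hsin
  all_goals
    rw [mul_pow]
    exact mul_mem (hs _) hsin

end SineElement

section Congruences

variable {F : Type*} [Field F]

/-- A polynomial divisible by all the prime factors of `M` is nilpotent modulo `M`. -/
theorem exists_dvd_pow_of_forall_prime_dvd {M : F[X]} (hM : M.Monic) {x : F[X]}
    (hx : ∀ L ∈ primeFactors M, L ∣ x) : ∃ n, M ∣ x ^ n := by
  induction hn : M.natDegree using Nat.strong_induction_on generalizing M with
  | _ n ih =>
    by_cases hu : IsUnit M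
    · exact ⟨0, hu.dvd⟩
    obtain ⟨L, hL, hirr, b, rfl⟩ := exists_monic_irreducible_factor M hu
    have hb : b.Monic := hL.of_mul_monic_left hM
    have hd : b.natDegree < n := by
      rw [← hn, hL.natDegree_mul hb]
      have := hirr.natDegree_pos
      omega
    obtain ⟨m, hm⟩ := ih _ hd hb
      (fun L' hL' => hx L' ⟨hL'.1, hL'.2.1, hL'.2.2.mul_left L⟩) rfl
    exact ⟨m + 1, pow_succ' x m ▸ mul_dvd_mul (hx L ⟨hL, hirr, dvd_mul_right _ _⟩) hm⟩

theorem mul_dvd_of_mem_primeFactors {M P Q x : F[X]} (hP : P ∈ primeFactors M)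
    (hQ : Q ∈ primeFactors M) (hPQ : P ≠ Q) (hPx : P ∣ x) (hQx : Q ∣ x) : P * Q ∣ x := by
  refine IsCoprime.mul_dvd ((dvd_or_isCoprime P Q hP.2.1).resolve_left fun h => hPQ ?_) hPx hQx
  exact eq_of_monic_of_associated hP.1 hQ.1
    (associated_of_dvd_dvd h (hP.2.1.dvd_symm hQ.2.1 h))

variable {p : ℕ} [Fact p.Prime] [CharP F p]

theorem dvd_sub_one_of_mk_pow_eq_one {M a : F[X]} {e : ℕ}
    (h : Ideal.Quotient.mk (Ideal.span {M}) a ^ p ^ e = 1) {L : F[X]} (hL : L ∈ primeFactors M) :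
    L ∣ a - 1 := by
  have h1 : M ∣ a ^ p ^ e - 1 := by
    rw [← Ideal.mem_span_singleton, ← Ideal.Quotient.eq, map_pow, h, map_one]
  have h2 : a ^ p ^ e - 1 = (a - 1) ^ p ^ e := by rw [sub_pow_char_pow, one_pow]
  exact hL.2.1.prime.dvd_of_dvd_pow (h2 ▸ hL.2.2.trans h1)

variable [Finite F]

theorem finite_primeFactors {M : F[X]} (hM : M.Monic) : (primeFactors M).Finite := by
  refine (finite_degree_lt (F := F) (M.natDegree + 1)).subset fun L hL => ?_
  refine (natDegree_lt_iff_degree_lt hL.1.ne_zero).1 ?_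
  exact Nat.lt_succ_of_le (natDegree_le_of_dvd hL.2.2 hM.ne_zero)

theorem mul_inv_pow_eq_one_of_val_pow_eq {R : Type*} [CommRing R] {b y : Rˣ} {n : ℕ}
    (h : (b : R) ^ n = (y : R) ^ n) : (b * y⁻¹) ^ n = 1 := by
  rw [mul_pow, inv_pow, mul_inv_eq_one]
  exact Units.ext (by rw [Units.val_pow_eq_pow_val, Units.val_pow_eq_pow_val, h])

/-- Modulo `p`-elements, `(𝔸 / M)^*` is generated by elements that are generators of `(𝔸 / L)^*`
and trivial modulo the other primes: a unit congruent to `1` modulo all the prime factors of `M` is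
unipotent, hence a `p`-element. -/
theorem exists_mem_closure_pow_eq_one {M : F[X]} (hM : M.Monic)
    {u : F[X] → (F[X] ⧸ Ideal.span {M})ˣ}
    (hu : ∀ L ∈ primeFactors M, IsFactorGenerator M L (u L)) (b : (F[X] ⧸ Ideal.span {M})ˣ) :
    ∃ y ∈ Subgroup.closure (u '' primeFactors M), ∃ e, (b * y⁻¹) ^ p ^ e = 1 := by
  classical
  let r := Ideal.Quotient.mk (Ideal.span {M})
  obtain ⟨b', hb'⟩ := Ideal.Quotient.mk_surjective (I := Ideal.span {M}) (b : F[X] ⧸ Ideal.span {M})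
  have hbL : ∀ L ∈ primeFactors M, ¬ L ∣ b' := fun L hL hdvd => by
    obtain ⟨c, hc⟩ := Ideal.Quotient.mk_surjective (I := Ideal.span {M})
      (↑b⁻¹ : F[X] ⧸ Ideal.span {M})
    have h1 : r (b' * c) = r 1 := by
      rw [map_mul, map_one]
      exact (congrArg₂ (· * ·) hb' hc).trans b.mul_inv
    have h2 := hL.2.2.trans (Ideal.mem_span_singleton.1 (Ideal.Quotient.eq.1 h1))
    exact hL.2.1.not_isUnit (isUnit_of_dvd_one ((dvd_sub_right (hdvd.mul_right c)).1 h2))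
  have hex : ∀ L, ∃ (g : F[X]) (n : ℕ), L ∈ primeFactors M → r g = u L ∧
      (∀ L' ∈ primeFactors M, L' ≠ L → L' ∣ g - 1) ∧ L ∣ g ^ n - b' := fun L => by
    by_cases hL : L ∈ primeFactors M
    · obtain ⟨-, g, hg, h1, h2⟩ := hu L hL
      obtain ⟨n, hn⟩ := h2 b' (hbL L hL)
      refine ⟨g, n, fun _ => ⟨hg, fun L' hL' hne => ?_, hn⟩⟩
      simpa using h1 L' hL' hne 1 (by simpa using hL'.2.2)
    · exact ⟨0, 0, fun h => absurd h hL⟩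
  choose g n hgn using hex
  set s := (finite_primeFactors hM).toFinset with hs
  have hmem : ∀ L, L ∈ s ↔ L ∈ primeFactors M := fun L => by simp [hs]
  set y := ∏ L ∈ s, u L ^ n L with hy
  set y' := ∏ L ∈ s, g L ^ n L with hy'
  have hry : r y' = y := by
    rw [hy, hy', map_prod, Units.coe_prod]
    refine Finset.prod_congr rfl fun L hL => ?_
    rw [map_pow, (hgn L ((hmem L).1 hL)).1, Units.val_pow_eq_pow_val]
  have hdvd : ∀ L ∈ primeFactors M, L ∣ b' - y' := fun L hL => by
    have h1 : L ∣ ∏ L' ∈ s.erase L, g L' ^ n L' - 1 := by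
      have h2 : ∀ L' ∈ s.erase L, Ideal.Quotient.mk (Ideal.span {L}) (g L' ^ n L') = 1 :=
        fun L' hL' => by
          obtain ⟨hne, hL's⟩ := Finset.mem_erase.1 hL'
          have h3 := (hgn L' ((hmem L').1 hL's)).2.1 L hL hne.symm
          rw [map_pow, Ideal.Quotient.eq.2 (Ideal.mem_span_singleton.2 h3), map_one, one_pow]
      rw [← Ideal.mem_span_singleton, ← Ideal.Quotient.eq, map_prod, Finset.prod_eq_one h2,
        map_one]
    rw [hy', ← Finset.mul_prod_erase s _ ((hmem L).2 hL)]
    have h4 : b' - g L ^ n L * ∏ L' ∈ s.erase L, g L' ^ n L' =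
        -(g L ^ n L - b') - g L ^ n L * (∏ L' ∈ s.erase L, g L' ^ n L' - 1) := by ring
    rw [h4]
    exact dvd_sub ((hgn L hL).2.2.neg_right) (h1.mul_left _)
  obtain ⟨m, hm⟩ := exists_dvd_pow_of_forall_prime_dvd hM hdvd
  have hpow : M ∣ b' ^ p ^ m - y' ^ p ^ m := by
    rw [← sub_pow_char_pow]
    exact hm.trans (pow_dvd_pow _ (Nat.lt_pow_self (Fact.out : p.Prime).one_lt).le)
  refine ⟨y, ?_, m, ?_⟩
  · exact prod_mem fun L hL => pow_mem
      (Subgroup.subset_closure (Set.mem_image_of_mem u ((hmem L).1 hL))) _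
  · refine mul_inv_pow_eq_one_of_val_pow_eq ?_
    rw [← hry, ← hb', ← map_pow, ← map_pow]
    exact Ideal.Quotient.eq.2 (Ideal.mem_span_singleton.2 hpow)

omit [Fact p.Prime] in
/-- The subgroup generated by elements of orders prime to `p` has no `p`-torsion. -/
theorem eq_one_of_mem_closure_of_pow_eq_one {G : Type*} [Group G]
    (hG : ∀ σ τ : G, σ * τ = τ * σ) {s : Set G}
    (hs : ∀ σ ∈ s, ∃ m, p.Coprime m ∧ σ ^ m = 1) {σ : G} (hσ : σ ∈ Subgroup.closure s) {e : ℕ}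
    (he : σ ^ p ^ e = 1) : σ = 1 := by
  have h : ∃ m, p.Coprime m ∧ σ ^ m = 1 := by
    clear he
    induction hσ using Subgroup.closure_induction with
    | mem x hx => exact hs x hx
    | one => exact ⟨1, Nat.coprime_one_right p, one_pow 1⟩
    | mul x y _ _ hx hy =>
      obtain ⟨m, hm, h1⟩ := hx
      obtain ⟨n, hn, h2⟩ := hy
      refine ⟨m * n, hm.mul_right hn, ?_⟩
      rw [Commute.mul_pow (hG x y), pow_mul, h1, one_pow, mul_comm, pow_mul, h2, one_pow, one_mul]
    | inv x _ hx =>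
      obtain ⟨m, hm, h1⟩ := hx
      exact ⟨m, hm, by rw [inv_pow, h1, inv_one]⟩
  obtain ⟨m, hm, h1⟩ := h
  exact Subgroup.mem_bot.1 (mem_of_pow_mem_of_coprime ⊥ (hm.pow_left e) (Subgroup.mem_bot.2 he)
    (Subgroup.mem_bot.2 h1))

end Congruences

section QuasiCyclotomicGroup

variable {F : Type*} [Field F] [Finite F]

theorem mul_algebraMap_div_eq_torsionPoint (π : Omega F) (g : F[X]) {D N : F[X]} (hN : N ≠ 0) :
    latticeExp π (π * algebraMap (RatFunc F) (Omega F)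
      (algebraMap F[X] (RatFunc F) g / algebraMap F[X] (RatFunc F) D)) =
      torsionPoint π (D * N) (g * N) := by
  have hN' : algebraMap F[X] (RatFunc F) N ≠ 0 :=
    (map_ne_zero_iff _ (RatFunc.algebraMap_injective F)).2 hN
  rw [torsionPoint, ← mul_div_mul_right _ _ hN', ← map_mul, ← map_mul, map_div₀, mul_comm (polyMap _),
    mul_div_assoc]
  rfl

variable {p : ℕ} [Fact p.Prime] [CharP F p] {M P Q : F[X]} (hM : M.Monic)
  (hP : P ∈ primeFactors M) (hQ : Q ∈ primeFactors M) (hPQ : P ≠ Q)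
  {π : Omega F} (hπ : IsCarlitzPeriod π)
  {K : IntermediateField (RatFunc F) (Omega F)} (hK : K = cyclotomicField π M)

include hM hP hQ hPQ hπ hK in
/-- The square of `u` lies in the cyclotomic field of conductor `P Q`, and an automorphism of
`p`-power order corresponds to some `a` with `a ≡ 1` modulo `P` and `Q`, hence fixes that field. -/
theorem exists_sq_uPQ_fixed {φ : (K ≃ₐ[RatFunc F] K) ≃* (F[X] ⧸ Ideal.span {M})ˣ}
    (hφ : ∀ (σ : K ≃ₐ[RatFunc F] K) (a : F[X]), Ideal.Quotient.mk (Ideal.span {M}) a = φ σ →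
      (σ ⟨_, torsionPoint_one_mem hK⟩ : Omega F) = torsionPoint π M a)
    {ι : Omega F} (hι : ι ^ (Nat.card F - 1) = -1) {sqrt : F[X] → Omega F}
    (hsqrt : ∀ f : F[X], sqrt f ^ 2 = polyMap f) (γ : Fˣ) :
    ∃ w : K, (w : Omega F) = uPQ π ι sqrt γ P Q ^ 2 ∧
      ∀ (σ : K ≃ₐ[RatFunc F] K) (e : ℕ), σ ^ p ^ e = 1 → σ w = w := by
  obtain ⟨N, hN⟩ := mul_dvd_of_mem_primeFactors hP hQ hPQ hP.2.2 hQ.2.2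
  have hPQ0 : P * Q ≠ 0 := mul_ne_zero hP.1.ne_zero hQ.1.ne_zero
  have hN0 : N ≠ 0 := fun h => hM.ne_zero (by rw [hN, h, mul_zero])
  have hpoint : ∀ g : F[X], latticeExp π (π * algebraMap (RatFunc F) (Omega F)
      (algebraMap F[X] (RatFunc F) g / algebraMap F[X] (RatFunc F) (P * Q))) =
      torsionPoint π M (g * N) := fun g => by
    rw [mul_algebraMap_div_eq_torsionPoint π g hN0, ← hN]
  have hwK : uPQ π ι sqrt γ P Q ^ 2 ∈ K := sq_uPQ_mem hι hsqrt γ hPQ0 K fun g => by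
    rw [hpoint]; exact torsionPoint_mem hπ hK _
  have hfix : ∀ (σ : K ≃ₐ[RatFunc F] K) (e : ℕ), σ ^ p ^ e = 1 → ∀ g : F[X],
      σ ⟨_, torsionPoint_mem hπ hK (g * N)⟩ = ⟨_, torsionPoint_mem hπ hK (g * N)⟩ := by
    intro σ e hσ g
    obtain ⟨a, ha⟩ := Ideal.Quotient.mk_surjective (I := Ideal.span {M})
      (φ σ : F[X] ⧸ Ideal.span {M})
    have h1 : Ideal.Quotient.mk (Ideal.span {M}) a ^ p ^ e = 1 := by
      rw [ha, ← Units.val_pow_eq_pow_val, ← map_pow, hσ, map_one, Units.val_one]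
    have h2 : P * Q ∣ a - 1 := mul_dvd_of_mem_primeFactors hP hQ hPQ
      (dvd_sub_one_of_mk_pow_eq_one h1 hP) (dvd_sub_one_of_mk_pow_eq_one h1 hQ)
    refine Subtype.ext ((algEquiv_torsionPoint hπ hK (hφ σ a ha) (g * N)).trans ?_)
    refine (torsionPoint_eq_iff hπ hM _ _).2 ?_
    have h3 : g * N * a - g * N = (a - 1) * N * g := by ring
    rw [h3]
    conv_lhs => rw [hN]
    exact (mul_dvd_mul_right h2 N).mul_right g
  refine ⟨⟨_, hwK⟩, rfl, fun σ e hσ => ?_⟩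
  have hwE : uPQ π ι sqrt γ P Q ^ 2 ∈
      (IntermediateField.fixedField (Subgroup.zpowers σ)).map K.val := by
    refine sq_uPQ_mem hι hsqrt γ hPQ0 _ fun g => ?_
    rw [hpoint]
    refine ⟨⟨_, torsionPoint_mem hπ hK (g * N)⟩, ?_, rfl⟩
    refine (IntermediateField.mem_fixedField_iff _ _).2 ?_
    rintro _ ⟨k, rfl⟩
    refine hfix (σ ^ k) e ?_ g
    rw [← zpow_natCast, zpow_comm, zpow_natCast, hσ, one_zpow]
  obtain ⟨x, hx, hxw⟩ := hwE
  have hx' : x = ⟨_, hwK⟩ := Subtype.ext hxw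
  rw [← hx']
  exact (IntermediateField.mem_fixedField_iff _ _).1 hx σ (Subgroup.mem_zpowers σ)

end QuasiCyclotomicGroup

end

end QuasiCyclotomic

theorem lemma2p2 {F : Type*} [Field F] [Finite F] (p : ℕ) [Fact p.Prime] [CharP F p] (hp : p ≠ 2)
    -- the conductor `M`, and two distinct monic prime factors of it
    (M P Q : F[X]) (hM : M.Monic) (hP : P ∈ primeFactors M) (hQ : Q ∈ primeFactors M)
    (hPQ : P ≠ Q)
    -- a generator of `F^*`, a Carlitz period, and the choices of roots in `Ω`
    (γ : Fˣ) (hγ : ∀ x : Fˣ, x ∈ Subgroup.zpowers γ)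
    (π : Omega F) (hπ : IsCarlitzPeriod π)
    (ι : Omega F) (hι : ι ^ (Nat.card F - 1) = -1)
    (sqrt : F[X] → Omega F) (hsqrt : ∀ f : F[X], sqrt f ^ 2 = polyMap f)
    (θ : Omega F) (hθ : θ ^ (Nat.card F - 1) = uPQ π ι sqrt γ P Q)
    -- `K` is the cyclotomic function field, and `K' = K(θ)`
    (K K' : IntermediateField (RatFunc F) (Omega F)) (hKK' : K ≤ K')
    (hK : K = cyclotomicField π M) (hK' : K' = quasiField K θ)
    -- `ε` is a generator of `Gal(K'/K)`
    (ε : K' ≃ₐ[RatFunc F] K') (hε : Subgroup.zpowers ε = liftings hKK' ⊥) :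
    -- the canonical isomorphism of `G = Gal(K/k)` with `(𝔸 / M)^*`
    ∃ φ : (K ≃ₐ[RatFunc F] K) ≃* (F[X] ⧸ Ideal.span {M})ˣ,
      (∀ (σ : K ≃ₐ[RatFunc F] K) (a : F[X]) (x : K),
        Ideal.Quotient.mk (Ideal.span {M}) a = φ σ → (x : Omega F) = latticeExp π (π / polyMap M) →
          (σ x : Omega F) = latticeExp π (polyMap a * π / polyMap M)) ∧
      ∀ S : Sylow p (K' ≃ₐ[RatFunc F] K'),
        (∀ (T : Sylow p (K ≃ₐ[RatFunc F] K)) (U : Sylow p (F[X] ⧸ Ideal.span {M})ˣ),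
          Subgroup.zpowers ε ≤ liftings hKK' T ∧
          ∃ _ : ((Subgroup.zpowers ε).subgroupOf (liftings hKK' T)).Normal,
            Nonempty (S ≃* liftings hKK' T ⧸
              (Subgroup.zpowers ε).subgroupOf (liftings hKK' T)) ∧
            Nonempty ((liftings hKK' T ⧸
              (Subgroup.zpowers ε).subgroupOf (liftings hKK' T)) ≃* T) ∧
            Nonempty (T ≃* U)) ∧
        -- `σ L` is associated to a generator of `(𝔸 / L)^*` for each `L`
        ∀ σ : F[X] → (K ≃ₐ[RatFunc F] K),
          (∀ L ∈ primeFactors M, IsFactorGenerator M L (φ (σ L))) →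
            ∃ f : (S × liftings hKK' (Subgroup.closure (σ '' primeFactors M))) ≃*
                (K' ≃ₐ[RatFunc F] K'),
              ∀ x, f x = (x.1 : K' ≃ₐ[RatFunc F] K') * (x.2 : K' ≃ₐ[RatFunc F] K') := by
  obtain ⟨φ, hφ⟩ := exists_galois_mulEquiv_units hπ hM hK
  refine ⟨φ, fun σ a x ha hx => ?_, fun S => ?_⟩
  · have hx' : x = ⟨_, torsionPoint_one_mem hK⟩ :=
      Subtype.ext (hx.trans (torsionPoint_one π M).symm)
    rw [hx']
    exact hφ σ a ha
  have hnormal : Normal (RatFunc F) K := (isGalois_cyclotomicField hπ hM hK).to_normal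
  have hU : ∀ x y : (F[X] ⧸ Ideal.span {M})ˣ, x * y = y * x := fun x y =>
    Units.ext (mul_comm (x : F[X] ⧸ Ideal.span {M}) y)
  have hG : ∀ σ τ : K ≃ₐ[RatFunc F] K, σ * τ = τ * σ := fun σ τ =>
    φ.injective (by
    rw [map_mul, map_mul]
    exact hU _ _)
  obtain ⟨w, hwu, hwfix⟩ := exists_sq_uPQ_fixed (p := p) hM hP hQ hPQ hπ hK hφ hι hsqrt γ
  have hw : (w : Omega F) = θ ^ (2 * (Nat.card F - 1)) := by
    rw [hwu, mul_comm, pow_mul, hθ]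
  obtain ⟨ρ, hρ⟩ := exists_restrictHom hKK'
  have hcomap : ∀ H : Subgroup (K ≃ₐ[RatFunc F] K), liftings hKK' H = Subgroup.comap ρ H :=
    fun H => by
      ext τ
      refine ⟨?_, fun hτ => ⟨ρ τ, hτ, (hρ τ _).2 rfl⟩⟩
      rintro ⟨σ, hσ, hτ⟩
      rwa [Subgroup.mem_comap, (hρ τ σ).1 hτ]
  have hεker : Subgroup.zpowers ε = ρ.ker := by rw [hε, hcomap]; rfl
  have hcenter : ∀ (g : K' ≃ₐ[RatFunc F] K') (e : ℕ), g ^ p ^ e = 1 →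
      g ∈ Subgroup.center (K' ≃ₐ[RatFunc F] K') := fun g e hg =>
    mem_center_of_pow_eq_one hp hK' hw hρ hwfix hG hg
  have hlift : ∀ (σ : K ≃ₐ[RatFunc F] K) (e : ℕ), σ ^ p ^ e = 1 →
      ∃ τ, τ ^ p ^ e = 1 ∧ ρ τ = σ := fun σ e hσ => by
    obtain ⟨τ, hτ, hτσ⟩ := exists_lift_of_pow_eq_one hp hKK' hK' hw hσ (hwfix σ e hσ)
    exact ⟨τ, hτ, (hρ τ σ).1 hτσ⟩
  have hker : ∀ (g : K' ≃ₐ[RatFunc F] K') (e : ℕ), g ^ p ^ e = 1 → ρ g = 1 → g = 1 :=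
    fun g e hg => eq_one_of_pow_eq_one_of_restrict hp hK' hw hρ hwfix hG hg
  refine ⟨fun T U => ?_, fun σ hσ => ?_⟩
  · rw [hεker, hcomap]
    obtain ⟨hn, ⟨f⟩⟩ := nonempty_quotient_mulEquiv hlift T
    obtain ⟨g⟩ := nonempty_sylow_mulEquiv hG hcenter hlift hker S T
    refine ⟨fun τ hτ => ?_, hn, ⟨g.trans f.symm⟩, ⟨f⟩, ?_⟩
    · rw [Subgroup.mem_comap, (MonoidHom.mem_ker).1 hτ]
      exact one_mem _
    · refine nonempty_sylow_mulEquiv (ρ := φ.toMonoidHom) hU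
        (fun g _ _ => Subgroup.mem_center_iff.2 fun τ => hG τ g) (fun u e hu => ?_)
        (fun g e _ hg => φ.injective (hg.trans (map_one φ).symm)) T U
      refine ⟨φ.symm u, ?_, φ.apply_symm_apply u⟩
      rw [← map_pow, hu, map_one]
  · rw [hcomap]
    refine exists_sylow_prod_mulEquiv hcenter hlift hker S _ (fun τ e hτ he => ?_) fun τ => ?_
    · refine eq_one_of_mem_closure_of_pow_eq_one hG ?_ hτ he
      rintro _ ⟨L, hL, rfl⟩
      refine ⟨_, coprime_natCard_pow_sub_one F p hL.2.1.natDegree_pos.ne', φ.injective ?_⟩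
      rw [map_pow, map_one]
      exact (hσ L hL).1
    · obtain ⟨y, hy, e, he⟩ := exists_mem_closure_pow_eq_one (p := p) hM
        (u := fun L => φ (σ L)) hσ (φ τ)
      refine ⟨φ.symm y, ?_, e, φ.injective ?_⟩
      · have h1 : (Subgroup.closure (σ '' primeFactors M)).map φ.toMonoidHom =
            Subgroup.closure ((fun L => φ (σ L)) '' primeFactors M) := by
          rw [MonoidHom.map_closure, ← Set.image_comp]
          rfl
        rw [← h1] at hy
        obtain ⟨z, hz, rfl⟩ := hy
        rw [MulEquiv.toMonoidHom_eq_coe, MonoidHom.coe_coe, MulEquiv.symm_apply_apply]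
        exact hz
      · rw [map_pow, map_mul, map_inv, MulEquiv.apply_symm_apply, he, map_one]
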